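/- Let $M$ be a complete connected (smooth, finite-dimensional) Riemannian manifold without boundary, let $x_0\in M$, let $\rho(x)=\operatorname{dist}(x_0,x)$ be the Riemannian distance to $x_0$, and let $f:M\to\mathbb{R}$ be a $C^2$ function. Let $g:[0,\infty)\to\mathbb{R}$ be piecewise continuous, i.e. $g$ has only finitely many discontinuities in each bounded interval and has finite one-sided limits at every point. Suppose that $$\operatorname{Hess} f(x)(v,v)\;\ge\; g(\rho(x))\,|v|^2\qquad\text{for all } x\in M,\ v\in T_xM .$$ Define $G:[0,\infty)\to\mathbb{R}$ by $$G(t)=f(x_0)-|\operatorname{grad} f(x_0)|\,t+\int_0^t\!\int_0^s g(u)\,du\,ds .$$ If $G$ is proper (preimages of compact sets are compact) and bounded from below, then $f$ is proper. -/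

import Mathlib

open Bundle FiberBundle
open scoped Manifold ContDiff Topology Bundle

set_option linter.unusedSectionVars false

namespace Riemann

variable {E : Type*} [NormedAddCommGroup E] [NormedSpace ℝ E] [FiniteDimensional ℝ E]
  {H : Type*} [TopologicalSpace H] (I : ModelWithCorners ℝ E H)
  {M : Type*} [TopologicalSpace M] [ChartedSpace H M]
  [RiemannianBundle (fun x : M => TangentSpace I x)]

/-- The right-hand side of the Koszul formula, so that `koszul I X Y Z x = ⟨∇_X Y, Z⟩ (x)`. -/
noncomputable def koszul (X Y Z : Π x : M, TangentSpace I x) (x : M) : ℝ :=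
  (1 / 2) * (mvfderiv I (fun y => inner ℝ (Y y) (Z y)) x (X x)
    + mvfderiv I (fun y => inner ℝ (X y) (Z y)) x (Y x)
    - mvfderiv I (fun y => inner ℝ (X y) (Y y)) x (Z x)
    + inner ℝ (VectorField.mlieBracket I X Y x) (Z x)
    - inner ℝ (VectorField.mlieBracket I X Z x) (Y x)
    - inner ℝ (VectorField.mlieBracket I Y Z x) (X x))

variable [IsManifold I ∞ M] [IsContMDiffRiemannianBundle I ∞ E (fun x : M => TangentSpace I x)]

instance finiteDimensional_tangentSpace (x : M) : FiniteDimensional ℝ (TangentSpace I x) :=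
  inferInstanceAs (FiniteDimensional ℝ E)

instance completeSpace_tangentSpace (x : M) : CompleteSpace (TangentSpace I x) :=
  FiniteDimensional.complete ℝ _

variable {I}

theorem mdifferentiableAt_inner {X Y : Π x : M, TangentSpace I x} {x : M}
    (hX : MDiffAt (T% X) x) (hY : MDiffAt (T% Y) x) :
    MDiffAt (fun y => inner ℝ (X y) (Y y)) x :=
  MDifferentiableAt.inner_bundle (F := E) (IB := I) (b := fun y : M => y)
    (E := fun x : M => TangentSpace I x) hX hY

theorem tensorialAt_koszul_left {Y Z : Π x : M, TangentSpace I x} {x : M}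
    (hY : MDiffAt (T% Y) x) (hZ : MDiffAt (T% Z) x) :
    TensorialAt I E (fun X => koszul I X Y Z x) x where
  smul {f X} hf hX := by
    simp only [koszul, Pi.smul_apply', inner_smul_left, inner_smul_right,
      mvfderiv_fun_mul hf (mdifferentiableAt_inner hX hZ), RCLike.conj_to_real,
      mvfderiv_fun_mul hf (mdifferentiableAt_inner hX hY),
      VectorField.mlieBracket_smul_left hf hX, inner_add_left, map_smul,
      add_apply, smul_apply, smul_eq_mul]
    ring
  add {X X'} hX hX' := by
    simp only [koszul, Pi.add_apply, inner_add_left, inner_add_right,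
      mvfderiv_fun_add (mdifferentiableAt_inner hX hZ) (mdifferentiableAt_inner hX' hZ),
      mvfderiv_fun_add (mdifferentiableAt_inner hX hY) (mdifferentiableAt_inner hX' hY),
      VectorField.mlieBracket_add_left hX hX', map_add, add_apply]
    ring

theorem tensorialAt_koszul_right {X Y : Π x : M, TangentSpace I x} {x : M}
    (hX : MDiffAt (T% X) x) (hY : MDiffAt (T% Y) x) :
    TensorialAt I E (fun Z => koszul I X Y Z x) x where
  smul {f Z} hf hZ := by
    simp only [koszul, Pi.smul_apply', inner_smul_left, inner_smul_right,
      mvfderiv_fun_mul hf (mdifferentiableAt_inner hX hZ), RCLike.conj_to_real,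
      mvfderiv_fun_mul hf (mdifferentiableAt_inner hY hZ),
      VectorField.mlieBracket_smul_right hf hZ, inner_add_left, map_smul,
      add_apply, smul_apply, smul_eq_mul]
    rw [real_inner_comm (Z x) (Y x), real_inner_comm (Z x) (X x)]
    ring
  add {Z Z'} hZ hZ' := by
    simp only [koszul, Pi.add_apply, inner_add_left, inner_add_right,
      mvfderiv_fun_add (mdifferentiableAt_inner hX hZ) (mdifferentiableAt_inner hX hZ'),
      mvfderiv_fun_add (mdifferentiableAt_inner hY hZ) (mdifferentiableAt_inner hY hZ'),
      VectorField.mlieBracket_add_right hZ hZ', map_add, add_apply]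
    ring

variable (I) in
/-- The vector `α♯` representing a covector `α` through the metric. -/
noncomputable def sharp (x : M) : (TangentSpace I x →L[ℝ] ℝ) →ₗ[ℝ] TangentSpace I x where
  toFun α := (InnerProductSpace.toDual ℝ (TangentSpace I x)).symm α
  map_add' α β := map_add _ α β
  map_smul' c α := by simp

theorem inner_sharp (x : M) (α : TangentSpace I x →L[ℝ] ℝ) (v : TangentSpace I x) :
    inner ℝ (sharp I x α) v = α v :=
  InnerProductSpace.toDual_symm_apply

open Classical in
variable (I) in
/-- `leviCivitaFun I Y x v = ∇_v Y`, the vector that represents `w ↦ ⟨∇_v Y, w⟩`. -/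
noncomputable def leviCivitaFun (Y : Π x : M, TangentSpace I x) (x : M) :
    TangentSpace I x →L[ℝ] TangentSpace I x :=
  if hY : MDiffAt (T% Y) x then
    LinearMap.toContinuousLinearMap (sharp I x ∘ₗ
      (TensorialAt.mkHom₂ (I := I) (F := E) (F' := E) (fun X Z => koszul I X Y Z x) x
        (fun _ hZ => tensorialAt_koszul_left hY hZ)
        (fun _ hX => tensorialAt_koszul_right hX hY)).toLinearMap)
  else 0

theorem inner_leviCivitaFun {X Y Z : Π x : M, TangentSpace I x} {x : M}
    (hX : MDiffAt (T% X) x) (hY : MDiffAt (T% Y) x) (hZ : MDiffAt (T% Z) x) :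
    inner ℝ (leviCivitaFun I Y x (X x)) (Z x) = koszul I X Y Z x := by
  rw [leviCivitaFun, dif_pos hY]
  refine Eq.trans ?_ (TensorialAt.mkHom₂_apply (fun _ hZ => tensorialAt_koszul_left hY hZ)
    (fun _ hX => tensorialAt_koszul_right hX hY) hX hZ)
  exact inner_sharp x _ _

theorem tangentEnd_ext {x : M} {A B : TangentSpace I x →L[ℝ] TangentSpace I x}
    (h : ∀ X Z : Π x : M, TangentSpace I x, MDiffAt (T% X) x → MDiffAt (T% Z) x →
      inner ℝ (A (X x)) (Z x) = inner ℝ (B (X x)) (Z x)) : A = B := by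
  ext v
  refine ext_inner_right ℝ fun w => ?_
  have := h (extend E v) (extend E w) (mdifferentiableAt_extend ..) (mdifferentiableAt_extend ..)
  simpa using this

variable (I M) in
/-- The Levi-Civita connection of the Riemannian manifold `M`. -/
noncomputable def leviCivita : CovariantDerivative I E (TangentSpace I : M → Type _) where
  toFun := leviCivitaFun I
  isCovariantDerivativeOnUniv :=
    { add := by
        intro Y Y' x hY hY' _
        refine tangentEnd_ext fun X Z hX hZ => ?_
        rw [inner_leviCivitaFun hX (mdifferentiableAt_add_section hY hY') hZ, add_apply,
          inner_add_left, inner_leviCivitaFun hX hY hZ, inner_leviCivitaFun hX hY' hZ]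
        simp only [koszul, Pi.add_apply, inner_add_left, inner_add_right,
          mvfderiv_fun_add (mdifferentiableAt_inner hY hZ) (mdifferentiableAt_inner hY' hZ),
          mvfderiv_fun_add (mdifferentiableAt_inner hX hY) (mdifferentiableAt_inner hX hY'),
          VectorField.mlieBracket_add_left hY hY', VectorField.mlieBracket_add_right hY hY',
          map_add, add_apply]
        ring
      leibniz := by
        intro Y f x hY hf _
        refine tangentEnd_ext fun X Z hX hZ => ?_
        rw [inner_leviCivitaFun hX (hf.smul_section hY) hZ, add_apply, smul_apply,
          inner_add_left, inner_smul_left, inner_leviCivitaFun hX hY hZ]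
        simp only [koszul, Pi.smul_apply', inner_smul_left, inner_smul_right, RCLike.conj_to_real,
          mvfderiv_fun_mul hf (mdifferentiableAt_inner hY hZ),
          mvfderiv_fun_mul hf (mdifferentiableAt_inner hX hY),
          VectorField.mlieBracket_smul_left hf hY, VectorField.mlieBracket_smul_right hf hY,
          inner_add_left, map_smul, add_apply, smul_apply, smul_eq_mul,
          ContinuousLinearMap.smulRight_apply]
        rw [real_inner_comm (X x) (Y x)]
        ring }

theorem torsion_leviCivita : (leviCivita I M).torsion = 0 := by
  rw [CovariantDerivative.torsion_eq_zero_iff]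
  intro X Y x hX hY
  refine ext_inner_right ℝ fun w => ?_
  have hZ : MDiffAt (T% (extend E w : Π x : M, TangentSpace I x)) x := mdifferentiableAt_extend ..
  have hw : w = (extend E w : Π x : M, TangentSpace I x) x := by simp
  rw [hw, inner_sub_left]
  erw [inner_leviCivitaFun hX hY hZ, inner_leviCivitaFun hY hX hZ]
  simp only [koszul]
  rw [VectorField.mlieBracket_swap_apply (V := Y) (W := X), inner_neg_left]
  simp only [real_inner_comm]
  ring

theorem isMetricCompatible_leviCivita {X Y Z : Π x : M, TangentSpace I x} {x : M}
    (hX : MDiffAt (T% X) x) (hY : MDiffAt (T% Y) x) (hZ : MDiffAt (T% Z) x) :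
    mvfderiv I (fun y => inner ℝ (Y y) (Z y)) x (X x) =
      inner ℝ (leviCivita I M Y x (X x)) (Z x) + inner ℝ (Y x) (leviCivita I M Z x (X x)) := by
  change _ = inner ℝ (leviCivitaFun I Y x (X x)) (Z x) + inner ℝ (Y x) (leviCivitaFun I Z x (X x))
  rw [inner_leviCivitaFun hX hY hZ, real_inner_comm, inner_leviCivitaFun hX hZ hY]
  simp only [koszul]
  rw [VectorField.mlieBracket_swap_apply (V := Z) (W := Y), inner_neg_left]
  simp only [real_inner_comm]
  ring

variable (I) in
/-- The gradient of `f`, characterized by `⟨grad f, v⟩ = df(v)`. -/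
noncomputable def grad (f : M → ℝ) (x : M) : TangentSpace I x :=
  sharp I x (mvfderiv I f x)

variable (I) in
/-- The Hessian `Hess f (v, w) = v(Wf) - (∇_v W)f`, where `W` is any field extending `w`. -/
noncomputable def hess (f : M → ℝ) (x : M) (v w : TangentSpace I x) : ℝ :=
  mvfderiv I (fun y => mvfderiv I f y (extend E w y)) x v
    - mvfderiv I f x (leviCivita I M (extend E w) x v)

theorem mdifferentiableAt_deriv_field {f : M → ℝ} (hf : ContMDiff I 𝓘(ℝ, ℝ) 2 f)
    {Y : Π x : M, TangentSpace I x} {x : M} (hY : MDiffAt (T% Y) x) :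
    MDiffAt (fun y => mvfderiv I f y (Y y)) x := by
  have h1 : ContMDiff I.tangent 𝓘(ℝ, ℝ).tangent 1 (tangentMap I 𝓘(ℝ, ℝ) f) :=
    hf.contMDiff_tangentMap (by norm_num)
  have h2 := (h1.mdifferentiableAt (x := (⟨x, Y x⟩ : TangentBundle I M)) one_ne_zero).comp x hY
  rw [mdifferentiableAt_totalSpace] at h2
  have h3 := h2.2
  simp only [Function.comp_def, tangentMap, trivializationAt_model_space_apply] at h3
  exact h3

theorem hess_eq {f : M → ℝ} (hf : ContMDiff I 𝓘(ℝ, ℝ) 2 f)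
    {X Y : Π x : M, TangentSpace I x} {x : M} (hY : MDiffAt (T% Y) x) :
    hess I f x (X x) (Y x) = mvfderiv I (fun y => mvfderiv I f y (Y y)) x (X x)
      - mvfderiv I f x (leviCivita I M Y x (X x)) := by
  have key : TensorialAt I E (fun Y : Π x : M, TangentSpace I x =>
      mvfderiv I (fun y => mvfderiv I f y (Y y)) x (X x)
        - mvfderiv I f x (leviCivita I M Y x (X x))) x :=
    { smul := by
        intro a Y ha hY
        rw [(leviCivita I M).isCovariantDerivativeOn.leibniz hY ha]
        simp only [Pi.smul_apply', map_smul, smul_eq_mul, add_apply, smul_apply, map_add,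
          mvfderiv_fun_mul ha (mdifferentiableAt_deriv_field hf hY),
          ContinuousLinearMap.smulRight_apply]
        ring
      add := by
        intro Y Y' hY hY'
        rw [(leviCivita I M).isCovariantDerivativeOn.add hY hY']
        simp only [Pi.add_apply, map_add, add_apply,
          mvfderiv_fun_add (mdifferentiableAt_deriv_field hf hY)
            (mdifferentiableAt_deriv_field hf hY')]
        ring }
  exact key.pointwise (mdifferentiableAt_extend ..) hY (by simp)

/-- `g` is piecewise continuous on `[0, ∞)`: it has finitely many discontinuities in each bounded
interval, and finite one-sided limits everywhere. Only the values of `g` on `[0, ∞)` matter. -/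
def PiecewiseContinuousOnHalfLine (g : ℝ → ℝ) : Prop :=
  (∀ T : ℝ, {t ∈ Set.Icc 0 T | ¬ ContinuousWithinAt g (Set.Ici 0) t}.Finite) ∧
  (∀ t : ℝ, 0 ≤ t → ∃ l : ℝ, Filter.Tendsto g (𝓝[>] t) (𝓝 l)) ∧
  (∀ t : ℝ, 0 < t → ∃ l : ℝ, Filter.Tendsto g (𝓝[<] t) (𝓝 l))

variable (I) in
/-- `G(t) = f(x₀) - |grad f(x₀)| t + ∫_0^t ∫_0^s g(u) du ds` on `[0, ∞)`. -/
noncomputable def comparison (f : M → ℝ) (x₀ : M) (g : ℝ → ℝ) (t : Set.Ici (0 : ℝ)) : ℝ :=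
  f x₀ - ‖grad I f x₀‖ * (t : ℝ) + ∫ s in (0 : ℝ)..t, ∫ u in (0 : ℝ)..s, g u

end Riemann

section

set_option maxSynthPendingDepth 3

section MetricVariation

variable {E : Type*} [NormedAddCommGroup E] [NormedSpace ℝ E]

theorem bilin_le (B : E →L[ℝ] E →L[ℝ] ℝ) {b : ℝ} (hB : ‖B‖ ≤ b) (v w : E) :
    |B v w| ≤ b * ‖v‖ * ‖w‖ := by
  have h := B.le_opNorm₂ v w
  rw [Real.norm_eq_abs] at h
  refine h.trans ?_
  gcongr

set_option maxHeartbeats 2000000 in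
/-- First-order expansion, with an error that is uniform near `u₀`, of the squared length of the
velocity `v` of a curve through `u` that is moved along `- s a (V₀ + A (u - u₀))`, where
`- β` is the derivative of the weight `a`. -/
theorem exists_nhds_metric_variation_le {G : E → E →L[ℝ] E →L[ℝ] ℝ}
    {G' : E →L[ℝ] E →L[ℝ] E →L[ℝ] ℝ} {u₀ : E} (hG : HasStrictFDerivAt G G' u₀)
    {dF : E → E →L[ℝ] ℝ} {H : E →L[ℝ] E →L[ℝ] ℝ} (hF : HasFDerivAt dF H u₀)
    (hsymm : ∀ u v w, G u v w = G u w v) {V₀ : E} (hV : G u₀ V₀ = dF u₀)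
    {A : E →L[ℝ] E} (hA : ∀ w, G u₀ (A w) + G' w V₀ = H w) {K : ℝ}
    (hK : ∀ v, K * G u₀ v v ≤ 1 / 2 * G' V₀ v v + G u₀ v (A v))
    {T : Set E} (hT : T ∈ 𝓝 u₀) (C : ℝ) {η : ℝ} (hη : 0 < η) :
    ∃ U ∈ 𝓝 u₀, ∀ r > 0, ∃ s₀ > 0, ∀ s, 0 < s → s < s₀ → ∀ u ∈ U, ∀ (v : E) (a β : ℝ),
      0 ≤ a → a ≤ 1 → 0 ≤ β → β * r ≤ C * ‖v‖ → β * ‖u - u₀‖ ≤ C * ‖v‖ →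
      u - (s * a) • (V₀ + A (u - u₀)) ∈ T ∧
      G (u - (s * a) • (V₀ + A (u - u₀)))
          (v + s • (β • (V₀ + A (u - u₀)) - a • A v)) (v + s • (β • (V₀ + A (u - u₀)) - a • A v))
        ≤ G u v v + 2 * s * (β * dF u v - a * K * G u v v + η * ‖v‖ ^ 2) := by
  obtain ⟨M, hM1, hMG', hMA, hMK, hMC, hMG, hMV⟩ : ∃ M : ℝ, 1 ≤ M ∧ ‖G'‖ ≤ M ∧ ‖A‖ ≤ M ∧ |K| ≤ M ∧
      |C| ≤ M ∧ ‖G u₀‖ ≤ M ∧ ‖V₀‖ ≤ M :=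
    ⟨1 + ‖G'‖ + ‖A‖ + |K| + |C| + ‖G u₀‖ + ‖V₀‖, by
      have := norm_nonneg G'; have := norm_nonneg A; have := abs_nonneg K; have := abs_nonneg C
      have := norm_nonneg (G u₀); have := norm_nonneg V₀
      refine ⟨?_, ?_, ?_, ?_, ?_, ?_, ?_⟩ <;> linarith⟩
  have hM0 : 0 < M := by linarith
  obtain ⟨δ, hδ0, hδ1, hδη⟩ : ∃ δ : ℝ, 0 < δ ∧ δ ≤ 1 ∧ 13 * M ^ 2 * δ ≤ η := by
    refine ⟨min 1 (η / (13 * M ^ 2)), by positivity, min_le_left _ _, ?_⟩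
    calc 13 * M ^ 2 * min 1 (η / (13 * M ^ 2)) ≤ 13 * M ^ 2 * (η / (13 * M ^ 2)) := by
          gcongr; exact min_le_right _ _
      _ = η := by field_simp
  have hstrict := (hasStrictFDerivAt_iff_isLittleO.1 hG).def hδ0
  rw [nhds_prod_eq, Filter.eventually_prod_self_iff'] at hstrict
  have hW : HasFDerivAt (𝕜 := ℝ) (fun u => G u (V₀ + A (u - u₀)) - dF u) 0 u₀ := by
    have h1 : HasFDerivAt (𝕜 := ℝ) (fun u => V₀ + A (u - u₀)) A u₀ :=
      (A.hasFDerivAt.comp u₀ ((hasFDerivAt_id u₀).sub_const u₀)).const_add V₀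
    have h2 := (hG.hasFDerivAt.clm_apply h1).sub hF
    convert! h2 using 1
    ext w x
    have := congrArg (fun L => L x) (hA w)
    simp at this ⊢
    linarith
  have hlit := hW.isLittleO.def hδ0
  obtain ⟨N, hN, hNs⟩ := hstrict
  obtain ⟨ρ, hρ0, hρ⟩ := Metric.mem_nhds_iff.1 (Filter.inter_mem (Filter.inter_mem hN hT) hlit)
  obtain ⟨ρ', hρ'0, hρ'ρ, hρ'δ⟩ : ∃ ρ' : ℝ, 0 < ρ' ∧ 2 * ρ' ≤ ρ ∧ ρ' ≤ δ :=
    ⟨min (ρ / 2) δ, by positivity, by linarith [min_le_left (ρ / 2) δ], min_le_right _ _⟩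
  refine ⟨Metric.ball u₀ ρ', Metric.ball_mem_nhds _ hρ'0, fun r hr => ?_⟩
  set Ω : ℝ := M / r * (2 * M) + M with hΩ
  have hΩ0 : 0 < Ω := by positivity
  have hs1 : 0 < ρ' / (2 * M) := by positivity
  have hs2 : 0 < η / (8 * M ^ 2 * Ω + 5 * M * Ω ^ 2) := by positivity
  refine ⟨min (ρ' / (2 * M)) (η / (8 * M ^ 2 * Ω + 5 * M * Ω ^ 2)), lt_min hs1 hs2, ?_⟩
  intro s hs0 hss u hu v a β ha0 ha1 hβ0 hβr hβu
  have hsM : s * (2 * M) ≤ ρ' := by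
    have := (hss.trans_le (min_le_left _ _)).le
    rwa [le_div_iff₀ (by positivity)] at this
  have hsη : s * (8 * M ^ 2 * Ω + 5 * M * Ω ^ 2) ≤ η := by
    have := (hss.trans_le (min_le_right _ _)).le
    rwa [le_div_iff₀ (by positivity)] at this
  have hn : 0 ≤ ‖v‖ := norm_nonneg v
  have hud : ‖u - u₀‖ ≤ ρ' := by simpa [dist_eq_norm] using (Metric.mem_ball.1 hu).le
  have hAu : ‖A (u - u₀)‖ ≤ M * ρ' := (A.le_opNorm _).trans (by gcongr)
  set W : E := V₀ + A (u - u₀) with hWdef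
  have hWn : ‖W‖ ≤ 2 * M := by
    have := norm_add_le V₀ (A (u - u₀))
    nlinarith
  set x : E := u - (s * a) • W with hx
  have hxu : ‖x - u‖ ≤ s * (2 * M) := by
    have : x - u = -((s * a) • W) := by simp [hx]
    rw [this, norm_neg, norm_smul, Real.norm_of_nonneg (by positivity)]
    calc s * a * ‖W‖ ≤ s * 1 * (2 * M) := by gcongr
      _ = _ := by ring
  have hxu₀ : ‖x - u₀‖ ≤ 2 * ρ' := by
    have := norm_add_le (x - u) (u - u₀)
    rw [sub_add_sub_cancel] at this
    linarith
  have hub : u ∈ Metric.ball u₀ ρ := Metric.ball_subset_ball (by linarith) hu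
  have hxb : x ∈ Metric.ball u₀ ρ := by
    rw [Metric.mem_ball, dist_eq_norm]
    have := norm_add_le (x - u) (u - u₀)
    rw [sub_add_sub_cancel] at this
    have : ‖u - u₀‖ < ρ' := by simpa [dist_eq_norm] using Metric.mem_ball.1 hu
    linarith
  have hu₀b : u₀ ∈ Metric.ball u₀ ρ := Metric.mem_ball_self hρ0
  refine ⟨(hρ hxb).1.2, ?_⟩
  have hLip : ∀ y ∈ Metric.ball u₀ ρ, ∀ z ∈ Metric.ball u₀ ρ, ‖G y - G z‖ ≤ 2 * M * ‖y - z‖ := by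
    intro y hy z hz
    have h1 := hNs y (hρ hy).1.1 z (hρ hz).1.1
    have h2 := norm_add_le (G y - G z - G' (y - z)) (G' (y - z))
    rw [sub_add_cancel] at h2
    have h3 := G'.le_opNorm (y - z)
    have := norm_nonneg (y - z)
    simp only at h1
    nlinarith
  -- the linearization of the metric along the displacement
  have e1 : G x v v ≤ G u v v - s * a * G' V₀ v v + s * (2 * M * δ + M ^ 2 * δ) * ‖v‖ ^ 2 := by
    have h1 := bilin_le _ (hNs x (hρ hxb).1.1 u (hρ hub).1.1) v v
    have h2 : G' (x - u) v v = - (s * a) * G' V₀ v v - s * a * G' (A (u - u₀)) v v := by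
      have : x - u = -((s * a) • W) := by simp [hx]
      rw [this, hWdef]
      simp
      ring
    have h3 : |G' (A (u - u₀)) v v| ≤ M ^ 2 * δ * ‖v‖ * ‖v‖ := by
      refine bilin_le _ ((G'.le_opNorm _).trans ?_) v v
      calc ‖G'‖ * ‖A (u - u₀)‖ ≤ M * (M * δ) := by gcongr; exact hAu.trans (by gcongr)
        _ = _ := by ring
    have h4 : - (s * a * G' (A (u - u₀)) v v) ≤ s * (M ^ 2 * δ * ‖v‖ * ‖v‖) := by
      have h5 := (abs_le.1 h3).1
      have h6 : 0 ≤ M ^ 2 * δ * ‖v‖ * ‖v‖ := by positivity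
      have h7 : s * a * (-(G' (A (u - u₀)) v v)) ≤ s * a * (M ^ 2 * δ * ‖v‖ * ‖v‖) := by
        gcongr; linarith
      have h8 : s * a * (M ^ 2 * δ * ‖v‖ * ‖v‖) ≤ s * 1 * (M ^ 2 * δ * ‖v‖ * ‖v‖) := by gcongr
      linarith
    have h5 : δ * ‖x - u‖ * ‖v‖ * ‖v‖ ≤ δ * (s * (2 * M)) * ‖v‖ * ‖v‖ := by gcongr
    have h6 := (abs_le.1 h1).2
    simp only [sub_apply] at h6
    rw [h2] at h6
    linarith
  set y : E := β • W - a • A v with hy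
  have hyn : ‖y‖ ≤ Ω * ‖v‖ := by
    have h1 : β ≤ M / r * ‖v‖ := by
      rw [div_mul_eq_mul_div, le_div_iff₀ hr]
      exact hβr.trans (by gcongr; exact (le_abs_self C).trans hMC)
    have h2 := norm_sub_le (β • W) (a • A v)
    rw [norm_smul, norm_smul, Real.norm_of_nonneg hβ0, Real.norm_of_nonneg ha0] at h2
    have h3 : β * ‖W‖ ≤ M / r * ‖v‖ * (2 * M) := by gcongr
    have h4 : a * ‖A v‖ ≤ 1 * (M * ‖v‖) := by
      gcongr
      exact (A.le_opNorm v).trans (by gcongr)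
    rw [hΩ]
    linarith
  have e2 : G x v y ≤ G u v y + 4 * M ^ 2 * Ω * s * ‖v‖ ^ 2 := by
    have h1 := bilin_le (G x - G u) (b := 2 * M * (s * (2 * M)))
      ((hLip x hxb u hub).trans (by gcongr)) v y
    have h2 : 2 * M * (s * (2 * M)) * ‖v‖ * ‖y‖ ≤ 2 * M * (s * (2 * M)) * ‖v‖ * (Ω * ‖v‖) := by
      gcongr
    have h3 := (abs_le.1 h1).2
    simp only [sub_apply] at h3
    linarith
  have e3 : β * G u v W ≤ β * dF u v + M * δ * ‖v‖ ^ 2 := by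
    have h1 := (hρ hub).2
    simp only [Set.mem_ofPred_eq, sub_self, map_zero, add_zero, hV, sub_zero,
      zero_apply] at h1
    have h2 := (G u W - dF u).le_of_opNorm_le h1 v
    rw [Real.norm_eq_abs] at h2
    have h3 := (abs_le.1 h2).2
    simp only [sub_apply] at h3
    rw [hsymm]
    have h4 : β * (G u W v - dF u v) ≤ β * (δ * ‖u - u₀‖ * ‖v‖) := by gcongr
    have h5 : δ * ‖v‖ * (β * ‖u - u₀‖) ≤ δ * ‖v‖ * (M * ‖v‖) :=
      mul_le_mul_of_nonneg_left
        (hβu.trans (by gcongr; exact (le_abs_self C).trans hMC)) (by positivity)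
    linarith
  have hGu : ‖G u - G u₀‖ ≤ 2 * M * δ :=
    (hLip u hub u₀ hu₀b).trans (by gcongr; linarith)
  have e4 : a * (K * G u v v) ≤ a * (1 / 2 * G' V₀ v v + G u v (A v)) + 4 * M ^ 2 * δ * ‖v‖ ^ 2 := by
    have h1 := (abs_le.1 (bilin_le _ hGu v (A v))).1
    simp only [sub_apply] at h1
    have h2 : 2 * M * δ * ‖v‖ * ‖A v‖ ≤ 2 * M * δ * ‖v‖ * (M * ‖v‖) := by
      gcongr
      exact (A.le_opNorm v).trans (by gcongr)
    have h3 := bilin_le _ hGu v v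
    simp only [sub_apply] at h3
    have h4 : K * (G u v v - G u₀ v v) ≤ M * (2 * M * δ * ‖v‖ * ‖v‖) := by
      refine (le_abs_self _).trans ?_
      rw [abs_mul]
      gcongr
    have h5 := hK v
    have h6 : a * (K * G u v v) ≤
        a * ((1 / 2 * G' V₀ v v + G u v (A v)) + 4 * M ^ 2 * δ * ‖v‖ ^ 2) := by
      gcongr
      linarith
    have h7 : a * (4 * M ^ 2 * δ * ‖v‖ ^ 2) ≤ 1 * (4 * M ^ 2 * δ * ‖v‖ ^ 2) := by gcongr
    linarith
  have e5 : G x y y ≤ 5 * M * Ω ^ 2 * ‖v‖ ^ 2 := by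
    have h1 : ‖G x‖ ≤ 5 * M := by
      have h2 := norm_add_le (G x - G u₀) (G u₀)
      rw [sub_add_cancel] at h2
      have h3 := hLip x hxb u₀ hu₀b
      have h4 : 2 * M * ‖x - u₀‖ ≤ 2 * M * (2 * 1) := by
        gcongr; linarith
      linarith
    have h2 := (abs_le.1 (bilin_le _ h1 y y)).2
    have h3 : 5 * M * ‖y‖ * ‖y‖ ≤ 5 * M * (Ω * ‖v‖) * (Ω * ‖v‖) := by gcongr
    linarith
  have e6 : G u v y = β * G u v W - a * G u v (A v) := by simp [hy]
  have e7 : G x (v + s • y) (v + s • y) = G x v v + 2 * s * G x v y + s ^ 2 * G x y y := by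
    simp only [map_add, map_smul, add_apply, smul_apply, smul_eq_mul]
    rw [hsymm x y v]
    ring
  have e8 : 2 * s * G x v y ≤ 2 * s * (G u v y + 4 * M ^ 2 * Ω * s * ‖v‖ ^ 2) := by gcongr
  have e9 : s ^ 2 * G x y y ≤ s ^ 2 * (5 * M * Ω ^ 2 * ‖v‖ ^ 2) := by gcongr
  have e10 : 2 * s * (β * G u v W) ≤ 2 * s * (β * dF u v + M * δ * ‖v‖ ^ 2) := by gcongr
  have e11 := mul_le_mul_of_nonneg_left e4 (by positivity : 0 ≤ 2 * s)
  have e12 : s * ‖v‖ ^ 2 * (s * (8 * M ^ 2 * Ω + 5 * M * Ω ^ 2)) ≤ s * ‖v‖ ^ 2 * η := by gcongr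
  have e13 : s * ‖v‖ ^ 2 * (13 * M ^ 2 * δ) ≤ s * ‖v‖ ^ 2 * η := by gcongr
  have e14 : s * ‖v‖ ^ 2 * δ * (4 * M) ≤ s * ‖v‖ ^ 2 * δ * (4 * M ^ 2) := by
    gcongr; nlinarith
  rw [e7]
  rw [e6] at e8
  linarith

end MetricVariation

namespace Riemann

section Chart

variable {E : Type*} [NormedAddCommGroup E] [NormedSpace ℝ E] [FiniteDimensional ℝ E]
  {H : Type*} [TopologicalSpace H] (I : ModelWithCorners ℝ E H) [I.Boundaryless]
  {M : Type*} [TopologicalSpace M] [ChartedSpace H M]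
  [RiemannianBundle (fun x : M => TangentSpace I x)]

/-- The constant vector field on `E` with value `v`. -/
def constField (v : E) (u : E) : TangentSpace 𝓘(ℝ, E) u := v

theorem contMDiffAt_constField (v u : E) :
    ContMDiffAt 𝓘(ℝ, E) 𝓘(ℝ, E).tangent 2 (T% (constField v)) u := by
  rw [contMDiffAt_section]
  simpa [constField] using! contMDiffAt_const

theorem mlieBracket_constField (v w : E) :
    VectorField.mlieBracket 𝓘(ℝ, E) (constField v) (constField w) = 0 := by
  rw [← VectorField.mlieBracketWithin_univ, VectorField.mlieBracketWithin_eq_lieBracketWithin]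
  ext y
  have h : ∀ v : E, fderivWithin ℝ (constField v) Set.univ y = 0 := fun v => by
    rw [show constField v = fun _ : E => v from rfl]
    exact fderivWithin_const_apply _
  have h' : VectorField.lieBracketWithin ℝ (constField v) (constField w) Set.univ y =
      fderivWithin ℝ (constField w) Set.univ y v - fderivWithin ℝ (constField v) Set.univ y w := rfl
  rw [h', h, h]
  exact sub_self (0 : E)

/-- The vector field that is constant with value `v` in the preferred chart at `p`. -/
noncomputable def chartField (p : M) (v : E) (x : M) : TangentSpace I x :=
  VectorField.mpullback I 𝓘(ℝ, E) (extChartAt I p) (constField v) x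

/-- The Riemannian metric read in the preferred chart at `p`. -/
noncomputable def chartMetric (p : M) (u : E) : E →L[ℝ] E →L[ℝ] ℝ :=
  letI L : E →L[ℝ] TangentSpace I ((extChartAt I p).symm u) :=
    (mfderiv I 𝓘(ℝ, E) (extChartAt I p) ((extChartAt I p).symm u)).inverse
  (innerSL ℝ (E := TangentSpace I ((extChartAt I p).symm u))).bilinearComp L L

variable {I}

theorem chartMetric_apply (p : M) (u v w : E) :
    chartMetric I p u v w = inner ℝ (chartField I p v ((extChartAt I p).symm u))
      (chartField I p w ((extChartAt I p).symm u)) := rfl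

theorem chartMetric_comm (p : M) (u v w : E) : chartMetric I p u v w = chartMetric I p u w v := by
  rw [chartMetric_apply, chartMetric_apply, real_inner_comm]

theorem chartMetric_extChartAt {p x : M} (hx : x ∈ (extChartAt I p).source) (v w : E) :
    chartMetric I p (extChartAt I p x) v w
      = inner ℝ (chartField I p v x) (chartField I p w x) := by
  rw [chartMetric_apply, (extChartAt I p).left_inv hx]

theorem chartMetric_self_nonneg (p : M) (u v : E) : 0 ≤ chartMetric I p u v v := by
  rw [chartMetric_apply]; exact real_inner_self_nonneg

variable [IsManifold I ∞ M] [IsContMDiffRiemannianBundle I ∞ E (fun x : M => TangentSpace I x)]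

theorem chartField_mfderiv {p x : M} (hx : x ∈ (extChartAt I p).source) (w : TangentSpace I x) :
    chartField I p (mfderiv I 𝓘(ℝ, E) (extChartAt I p) x w) x = w :=
  have : IsManifold I 1 M := inferInstance
  (isInvertible_mfderiv_extChartAt hx).inverse_apply_self w

theorem mfderiv_chartField {p x : M} (hx : x ∈ (extChartAt I p).source) (v : E) :
    mfderiv I 𝓘(ℝ, E) (extChartAt I p) x (chartField I p v x) = v :=
  have : IsManifold I 1 M := inferInstance
  (isInvertible_mfderiv_extChartAt hx).self_apply_inverse v

theorem contMDiffAt_chartField {p x : M} (hx : x ∈ (extChartAt I p).source) (v : E) :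
    ContMDiffAt I I.tangent 2 (T% (chartField I p v)) x := by
  have : IsManifold I 1 M := inferInstance
  have : IsManifold I 3 M := inferInstance
  refine ContMDiffAt.mpullback_vectorField_preimage (n := 3) ?_ ?_ (isInvertible_mfderiv_extChartAt hx)
    (by norm_num)
  · exact contMDiffAt_constField v _
  · exact contMDiffAt_extChartAt' (by simpa using hx)

theorem mdifferentiableAt_chartField {p x : M} (hx : x ∈ (extChartAt I p).source) (v : E) :
    MDiffAt (T% (chartField I p v)) x :=
  (contMDiffAt_chartField hx v).mdifferentiableAt (by norm_num)

theorem mlieBracket_chartField {p x : M} (hx : x ∈ (extChartAt I p).source) (v w : E) :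
    VectorField.mlieBracket I (chartField I p v) (chartField I p w) x = 0 := by
  have : IsManifold I 3 M := inferInstance
  have : IsManifold I (minSmoothness ℝ 3) M := by simpa using this
  have h := VectorField.mpullback_mlieBracket (I := I) (I' := 𝓘(ℝ, E)) (f := extChartAt I p)
    (V := constField v) (W := constField w) (x₀ := x) (n := 3)
    ((contMDiffAt_constField v _).mdifferentiableAt (by norm_num))
    ((contMDiffAt_constField w _).mdifferentiableAt (by norm_num))
    (contMDiffAt_extChartAt' (by simpa using hx)) (by simp; norm_num)
  refine h.symm.trans ?_
  rw [mlieBracket_constField, VectorField.mpullback_zero]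
  rfl

theorem contDiffOn_chartMetric (p : M) :
    ContDiffOn ℝ 2 (chartMetric I p) (extChartAt I p).target := by
  rw [contDiffOn_clm_apply]
  intro v
  rw [contDiffOn_clm_apply]
  intro w u hu
  have hx := (extChartAt I p).map_target hu
  have h1 : ContMDiffAt I 𝓘(ℝ, ℝ) 2
      (fun x => inner ℝ (chartField I p v x) (chartField I p w x)) ((extChartAt I p).symm u) :=
    have : IsContMDiffRiemannianBundle I 2 E (fun x : M => TangentSpace I x) :=
      .of_le (n := ∞) ENat.LEInfty.out
    ContMDiffAt.inner_bundle (F := E) (IB := I) (b := fun y : M => y)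
      (E := fun x : M => TangentSpace I x) (contMDiffAt_chartField hx v)
      (contMDiffAt_chartField hx w)
  have : IsManifold I 2 M := inferInstance
  have h2 := h1.comp_contMDiffWithinAt u (contMDiffOn_extChartAt_symm p u hu)
  exact h2.contDiffWithinAt

theorem contDiffAt_chartMetric (p : M) : ContDiffAt ℝ 2 (chartMetric I p) (extChartAt I p p) :=
  (contDiffOn_chartMetric p).contDiffAt (extChartAt_target_mem_nhds p)

section

attribute [local instance] normedAddCommGroupTangentSpaceVectorSpace
attribute [local instance] normedSpaceTangentSpaceVectorSpace

theorem exists_norm_mfderiv_extChartAt_le (p : M) :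
    ∃ C > 0, ∀ᶠ x in 𝓝 p, ∀ (w : TangentSpace I x) (v : E),
      mfderiv I 𝓘(ℝ, E) (extChartAt I p) x w = v → ‖v‖ ≤ C * ‖w‖ := by
  have : IsContinuousRiemannianBundle E (fun x : M => TangentSpace I x) := by
    obtain ⟨g, hg, h⟩ := ‹IsContMDiffRiemannianBundle I ∞ E
      (fun x : M => TangentSpace I x)›.exists_contMDiff
    exact ⟨g, hg.continuous, h⟩
  obtain ⟨C, hC, h⟩ := eventually_norm_mfderiv_extChartAt_lt I p
  refine ⟨C, hC, ?_⟩
  filter_upwards [h] with x hx w v hv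
  subst hv
  exact (mfderiv I 𝓘(ℝ, E) (extChartAt I p) x).le_of_opNorm_le hx.le w

end

/-- The Euclidean norm is bounded by the Riemannian one near the centre of a chart. -/
theorem exists_norm_sq_le_chartMetric (p : M) :
    ∃ C > 0, ∀ᶠ u in 𝓝 (extChartAt I p p), ∀ v : E, ‖v‖ ^ 2 ≤ C ^ 2 * chartMetric I p u v v := by
  obtain ⟨C, hC, h⟩ := exists_norm_mfderiv_extChartAt_le (I := I) p
  refine ⟨C, hC, ?_⟩
  have hc : ContinuousAt (extChartAt I p).symm (extChartAt I p p) := continuousAt_extChartAt_symm p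
  have hp : (extChartAt I p).symm (extChartAt I p p) = p := extChartAt_to_inv p
  filter_upwards [hc.eventually (by rw [hp]; exact h), extChartAt_target_mem_nhds p] with u hu hut v
  have h2 := hu _ v (mfderiv_chartField ((extChartAt I p).map_target hut) v)
  rw [chartMetric_apply, real_inner_self_eq_norm_sq, ← mul_pow]
  exact pow_le_pow_left₀ (norm_nonneg _) h2 2

theorem mvfderiv_chartField {f : M → ℝ} {p x : M} (hx : x ∈ (extChartAt I p).source)
    (hf : MDifferentiableAt I 𝓘(ℝ, ℝ) f x) (v : E) :
    mvfderiv I f x (chartField I p v x)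
      = fderiv ℝ (f ∘ (extChartAt I p).symm) (extChartAt I p x) v := by
  have : IsManifold I 1 M := inferInstance
  have hsymm : MDifferentiableAt 𝓘(ℝ, E) I (extChartAt I p).symm (extChartAt I p x) :=
    ((contMDiffOn_extChartAt_symm (n := 1) p).mdifferentiableOn one_ne_zero _
      ((extChartAt I p).map_source hx)).mdifferentiableAt
      ((isOpen_extChartAt_target p).mem_nhds ((extChartAt I p).map_source hx))
  have hF : MDifferentiableAt 𝓘(ℝ, E) 𝓘(ℝ, ℝ) (f ∘ (extChartAt I p).symm) (extChartAt I p x) :=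
    MDifferentiableAt.comp_of_eq _ hf hsymm ((extChartAt I p).left_inv hx)
  have hφ : MDifferentiableAt I 𝓘(ℝ, E) (extChartAt I p) x :=
    mdifferentiableAt_extChartAt (by simpa using hx)
  have h1 : f =ᶠ[𝓝 x] (f ∘ (extChartAt I p).symm) ∘ extChartAt I p := by
    filter_upwards [extChartAt_source_mem_nhds' hx] with y hy
    simp only [Function.comp_apply, (extChartAt I p).left_inv hy]
  have h2 : mvfderiv I f x = mvfderiv I ((f ∘ (extChartAt I p).symm) ∘ extChartAt I p) x := by
    simp only [mvfderiv, h1.mfderiv_eq]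
    rfl
  rw [h2, mvfderiv_comp_apply x hF hφ, mfderiv_chartField hx]
  simp only [mvfderiv, mfderiv_eq_fderiv]
  rfl

theorem contDiffOn_chart {f : M → ℝ} (hf : ContMDiff I 𝓘(ℝ, ℝ) 2 f) (p : M) :
    ContDiffOn ℝ 2 (f ∘ (extChartAt I p).symm) (extChartAt I p).target := by
  have : IsManifold I 2 M := inferInstance
  exact (hf.comp_contMDiffOn (contMDiffOn_extChartAt_symm p)).contDiffOn

end Chart
end Riemann

namespace Riemann

section Chart

variable {E : Type*} [NormedAddCommGroup E] [NormedSpace ℝ E] [FiniteDimensional ℝ E]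
  {H : Type*} [TopologicalSpace H] {I : ModelWithCorners ℝ E H} [I.Boundaryless]
  {M : Type*} [TopologicalSpace M] [ChartedSpace H M]
  [RiemannianBundle (fun x : M => TangentSpace I x)]
  [IsManifold I ∞ M] [IsContMDiffRiemannianBundle I ∞ E (fun x : M => TangentSpace I x)]

theorem inner_grad (f : M → ℝ) (x : M) (v : TangentSpace I x) :
    inner ℝ (grad I f x) v = mvfderiv I f x v :=
  inner_sharp x _ v

theorem chartMetric_grad {f : M → ℝ} {p : M} (hf : MDifferentiableAt I 𝓘(ℝ, ℝ) f p) {V₀ : E}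
    (hV : chartField I p V₀ p = grad I f p) :
    chartMetric I p (extChartAt I p p) V₀
      = fderiv ℝ (f ∘ (extChartAt I p).symm) (extChartAt I p p) := by
  ext w
  rw [chartMetric_extChartAt (mem_extChartAt_source p), hV, inner_grad,
    mvfderiv_chartField (mem_extChartAt_source p) hf]

theorem mvfderiv_inner_chartField (p : M) (v w z : E) :
    mvfderiv I (fun x => inner ℝ (chartField I p v x) (chartField I p w x)) p (chartField I p z p)
      = fderiv ℝ (chartMetric I p) (extChartAt I p p) z v w := by
  have hp := mem_extChartAt_source (I := I) p
  rw [mvfderiv_chartField hp (mdifferentiableAt_inner (mdifferentiableAt_chartField hp v)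
    (mdifferentiableAt_chartField hp w))]
  have hG := (contDiffAt_chartMetric (I := I) p).differentiableAt (by norm_num)
  have h : HasFDerivAt (fun u => chartMetric I p u v w)
      (((fderiv ℝ (chartMetric I p) (extChartAt I p p)).flip v).flip w) (extChartAt I p p) := by
    have h1 := (hG.hasFDerivAt.clm_apply (hasFDerivAt_const v _)).clm_apply (hasFDerivAt_const w _)
    convert! h1 using 1
    ext z
    simp
  exact congrArg (fun L => L z) h.fderiv

/-- The Hessian in coordinates. -/
theorem hess_chartField {f : M → ℝ} (hf : ContMDiff I 𝓘(ℝ, ℝ) 2 f) {p : M} {V₀ : E}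
    (hV : chartField I p V₀ p = grad I f p) (v : E) :
    hess I f p (chartField I p v p) (chartField I p v p)
      = fderiv ℝ (fderiv ℝ (f ∘ (extChartAt I p).symm)) (extChartAt I p p) v v
        - fderiv ℝ (chartMetric I p) (extChartAt I p p) v v V₀
        + 1 / 2 * fderiv ℝ (chartMetric I p) (extChartAt I p p) V₀ v v := by
  have hp := mem_extChartAt_source (I := I) p
  have hX := mdifferentiableAt_chartField hp v
  rw [hess_eq hf (X := chartField I p v) hX]
  have h1 : mvfderiv I (fun y => mvfderiv I f y (chartField I p v y)) p (chartField I p v p)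
      = fderiv ℝ (fderiv ℝ (f ∘ (extChartAt I p).symm)) (extChartAt I p p) v v := by
    rw [mvfderiv_chartField hp (mdifferentiableAt_deriv_field hf hX)]
    have h2 : (fun y => mvfderiv I f y (chartField I p v y)) ∘ (extChartAt I p).symm
        =ᶠ[𝓝 (extChartAt I p p)] fun u => fderiv ℝ (f ∘ (extChartAt I p).symm) u v := by
      filter_upwards [extChartAt_target_mem_nhds (I := I) p] with u hu
      rw [Function.comp_apply, mvfderiv_chartField ((extChartAt I p).map_target hu)
        (hf.mdifferentiable (by norm_num) _), (extChartAt I p).right_inv hu]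
    rw [h2.fderiv_eq]
    have h3 : DifferentiableAt ℝ (fderiv ℝ (f ∘ (extChartAt I p).symm)) (extChartAt I p p) :=
      (((contDiffOn_chart hf p).contDiffAt (extChartAt_target_mem_nhds p)).fderiv_right
        (m := 1) (by norm_num)).differentiableAt (by norm_num)
    have h4 := h3.hasFDerivAt.clm_apply (hasFDerivAt_const v (extChartAt I p p))
    rw [h4.fderiv]
    simp
  have h5 : mvfderiv I f p (leviCivita I M (chartField I p v) p (chartField I p v p))
      = koszul I (chartField I p v) (chartField I p v) (chartField I p V₀) p := by
    rw [← inner_leviCivitaFun hX hX (mdifferentiableAt_chartField hp V₀), hV, real_inner_comm,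
      inner_grad]
    rfl
  rw [h1, h5, koszul, mvfderiv_inner_chartField, mvfderiv_inner_chartField,
    mlieBracket_chartField hp, mlieBracket_chartField hp]
  simp only [inner_zero_left]
  ring

end Chart
end Riemann

section CurveVariation

variable {E : Type*} [NormedAddCommGroup E] [NormedSpace ℝ E]

theorem sqrt_le_add_of_le_sq {Q x y : ℝ} (hx : 0 ≤ x) (hy : x = 0 → y = 0) (hQ0 : 0 ≤ Q)
    (hQ : Q ≤ x ^ 2 + 2 * x * y) : √Q ≤ x + y := by
  rcases hx.eq_or_lt with rfl | hx
  · have : Q = 0 := by nlinarith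
    simp [this, hy rfl]
  · have h1 : 0 ≤ x + 2 * y := by
      have : 0 ≤ x * (x + 2 * y) := by linarith
      exact nonneg_of_mul_nonneg_right this hx
    rw [Real.sqrt_le_iff]
    constructor <;> nlinarith [sq_nonneg y]

theorem exists_curve_variation {G : E → E →L[ℝ] E →L[ℝ] ℝ}
    {G' : E →L[ℝ] E →L[ℝ] E →L[ℝ] ℝ} {u₀ : E} (hG : HasStrictFDerivAt G G' u₀)
    {F : E → ℝ} {dF : E → E →L[ℝ] ℝ} {H : E →L[ℝ] E →L[ℝ] ℝ} (hF : HasFDerivAt dF H u₀)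
    (hsymm : ∀ u v w, G u v w = G u w v) {V₀ : E} (hV : G u₀ V₀ = dF u₀)
    {A : E →L[ℝ] E} (hA : ∀ w, G u₀ (A w) + G' w V₀ = H w) {K : ℝ}
    (hK : ∀ v, K * G u₀ v v ≤ 1 / 2 * G' V₀ v v + G u₀ v (A v))
    {T : Set E} (hT : T ∈ 𝓝 u₀) (hGT : ContinuousOn G T) (hFT : ∀ u ∈ T, HasFDerivAt F (dF u) u)
    (hdFT : ContinuousOn dF T) (hG0 : ∀ u v, 0 ≤ G u v v)
    {C : ℝ} (hC0 : 0 < C) (hC : ∀ᶠ u in 𝓝 u₀, ∀ v, ‖v‖ ^ 2 ≤ C ^ 2 * G u v v)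
    {η : ℝ} (hη : 0 < η) :
    ∃ U ∈ 𝓝 u₀, ∀ r > 0, ∃ s > 0, u₀ - s • V₀ ∈ T ∧ ∀ (u u' : ℝ → E),
      (∀ t ∈ Set.Icc (0 : ℝ) 1, HasDerivWithinAt u (u' t) (Set.Icc 0 1) t) →
      ContinuousOn u' (Set.Icc 0 1) → (∀ t ∈ Set.Icc (0 : ℝ) 1, u t ∈ U) → u 0 = u₀ →
      ∀ l : ℝ, l = (∫ t in (0 : ℝ)..1, √(G (u t) (u' t) (u' t))) → r ≤ l →
      ∃ w w' : ℝ → E, (∀ t ∈ Set.Icc (0 : ℝ) 1, HasDerivWithinAt w (w' t) (Set.Icc 0 1) t) ∧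
        ContinuousOn w' (Set.Icc 0 1) ∧ (∀ t ∈ Set.Icc (0 : ℝ) 1, w t ∈ T) ∧
        w 0 = u₀ - s • V₀ ∧ w 1 = u 1 ∧
        (∫ t in (0 : ℝ)..1, √(G (w t) (w' t) (w' t)))
          ≤ l + s * ((F (u 1) - F u₀) / l - K * l / 2 + η * l) := by
  set B : ℝ := ‖G u₀‖ + 1 with hB
  have hB0 : 0 < B := by positivity
  have hGB : ∀ᶠ u in 𝓝 u₀, ‖G u‖ ≤ B := by
    have h := hG.continuousAt.norm
    filter_upwards [h.eventually (eventually_lt_nhds (lt_add_one ‖G u₀‖))] with u hu using hu.le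
  obtain ⟨U, hU, hvar⟩ := exists_nhds_metric_variation_le hG hF hsymm hV hA hK hT
    (√B + C * √B) (η := η / C ^ 2) (by positivity)
  refine ⟨U ∩ T ∩ {u | (∀ v, ‖v‖ ^ 2 ≤ C ^ 2 * G u v v) ∧ ‖G u‖ ≤ B},
    Filter.inter_mem (Filter.inter_mem hU hT) (hC.and hGB), fun r hr => ?_⟩
  obtain ⟨s₀, hs₀, hvar⟩ := hvar r hr
  refine ⟨s₀ / 2, by positivity, ?_, ?_⟩
  · simpa using (hvar (s₀ / 2) (by positivity) (by linarith) u₀ (mem_of_mem_nhds hU) 0 1 0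
      zero_le_one le_rfl le_rfl (by simp) (by simp)).1
  intro u u' hu hu' huU hu0 l hl hrl
  replace hvar := hvar (s₀ / 2) (by positivity) (by linarith)
  set s : ℝ := s₀ / 2
  have hs : 0 < s := by positivity
  have hl0 : 0 < l := hr.trans_le hrl
  have huc : ContinuousOn u (Set.Icc 0 1) := fun t ht => (hu t ht).continuousWithinAt
  have hGu : ContinuousOn (fun t => G (u t)) (Set.Icc 0 1) :=
    hGT.comp huc fun t ht => (huU t ht).1.2
  set N : ℝ → ℝ := fun t => √(G (u t) (u' t) (u' t)) with hN
  have hNc : ContinuousOn N (Set.Icc 0 1) := ((hGu.clm_apply hu').clm_apply hu').sqrt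
  have hN0 : ∀ t, 0 ≤ N t := fun t => Real.sqrt_nonneg _
  have hNsq : ∀ t, N t ^ 2 = G (u t) (u' t) (u' t) := fun t => Real.sq_sqrt (hG0 _ _)
  set N₁ : ℝ → ℝ := Set.IccExtend (zero_le_one' ℝ) (Set.domRestrict (Set.Icc 0 1) N) with hN₁
  have hN₁c : Continuous N₁ := hNc.domRestrict.Icc_extend'
  have hN₁N : ∀ t ∈ Set.Icc (0 : ℝ) 1, N₁ t = N t := fun t ht => by
    rw [hN₁, Set.IccExtend_of_mem _ _ ht]
    rfl
  set L : ℝ → ℝ := fun t => ∫ τ in (0 : ℝ)..t, N₁ τ with hL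
  have hLd : ∀ t ∈ Set.Icc (0 : ℝ) 1, HasDerivAt L (N t) t := fun t ht => by
    rw [← hN₁N t ht]
    exact intervalIntegral.integral_hasDerivAt_right (hN₁c.intervalIntegrable _ _)
      (hN₁c.stronglyMeasurableAtFilter _ _) hN₁c.continuousAt
  have hL0 : L 0 = 0 := by simp [hL]
  have hL1 : L 1 = l := by
    rw [hl]
    refine intervalIntegral.integral_congr fun t ht => ?_
    rw [Set.uIcc_of_le zero_le_one] at ht
    exact hN₁N t ht
  have hN₁0 : ∀ t, 0 ≤ N₁ t := fun t => Real.sqrt_nonneg _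
  have hLmono : Monotone L := by
    intro t t' htt'
    have := intervalIntegral.integral_interval_sub_left (a := 0) (b := t') (c := t)
      (hN₁c.intervalIntegrable (μ := MeasureTheory.volume) _ _) (hN₁c.intervalIntegrable _ _)
    have h2 : 0 ≤ ∫ τ in t..t', N₁ τ :=
      intervalIntegral.integral_nonneg htt' fun τ _ => hN₁0 τ
    simp only [hL]
    linarith
  have hLnn : ∀ t ∈ Set.Icc (0 : ℝ) 1, 0 ≤ L t := fun t ht => hL0 ▸ hLmono ht.1
  have hLle : ∀ t ∈ Set.Icc (0 : ℝ) 1, L t ≤ l := fun t ht => hL1 ▸ hLmono ht.2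
  set a : ℝ → ℝ := fun t => 1 - L t / l with ha
  have had : ∀ t ∈ Set.Icc (0 : ℝ) 1, HasDerivAt a (-(N t / l)) t := fun t ht =>
    ((hLd t ht).div_const l).const_sub 1
  have ha0 : ∀ t ∈ Set.Icc (0 : ℝ) 1, 0 ≤ a t := fun t ht => by
    simp only [ha, sub_nonneg]
    exact (div_le_one hl0).2 (hLle t ht)
  have ha1 : ∀ t ∈ Set.Icc (0 : ℝ) 1, a t ≤ 1 := fun t ht => by
    have := div_nonneg (hLnn t ht) hl0.le
    simp only [ha]
    linarith
  have hac : ContinuousOn a (Set.Icc 0 1) := fun t ht => (had t ht).continuousAt.continuousWithinAt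
  have hnorm : ∀ t ∈ Set.Icc (0 : ℝ) 1, ‖u' t‖ ≤ C * N t := fun t ht => by
    refine abs_le_of_sq_le_sq' ?_ (mul_nonneg hC0.le (hN0 t)) |>.2
    rw [mul_pow, hNsq]
    exact (huU t ht).2.1 _
  have hNnorm : ∀ t ∈ Set.Icc (0 : ℝ) 1, N t ≤ √B * ‖u' t‖ := fun t ht => by
    rw [Real.sqrt_le_iff]
    refine ⟨by positivity, ?_⟩
    rw [mul_pow, Real.sq_sqrt hB0.le]
    have := (abs_le.1 (bilin_le _ (huU t ht).2.2 (u' t) (u' t))).2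
    linarith
  have hdisp : ∀ t ∈ Set.Icc (0 : ℝ) 1, ‖u t - u₀‖ ≤ C * l := fun t ht => by
    have h1 : ∀ x ∈ Set.Icc (0 : ℝ) 1, ‖u x - u₀‖ ≤ C * L x := by
      refine image_norm_le_of_norm_deriv_right_le_deriv_boundary' (f' := u')
        (B' := fun x => C * N x) (huc.sub continuousOn_const) (fun x hx => ?_) (by simp [hu0, hL0])
        ?_ (fun x hx => ?_) (fun x hx => hnorm x ⟨hx.1, hx.2.le⟩)
      · exact (((hu x ⟨hx.1, hx.2.le⟩).mono_of_mem_nhdsWithin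
          (Icc_mem_nhdsGE_of_mem hx))).sub_const _
      · exact fun x hx => ((hLd x hx).continuousAt.const_mul C).continuousWithinAt
      · exact ((hLd x ⟨hx.1, hx.2.le⟩).const_mul C).hasDerivWithinAt
    exact (h1 t ht).trans (by gcongr; exact hLle t ht)
  set W : ℝ → E := fun t => V₀ + A (u t - u₀) with hW
  have hWd : ∀ t ∈ Set.Icc (0 : ℝ) 1, HasDerivWithinAt W (A (u' t)) (Set.Icc 0 1) t := fun t ht =>
    (A.hasFDerivAt.comp_hasDerivWithinAt t ((hu t ht).sub_const u₀)).const_add V₀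
  have hWc : ContinuousOn W (Set.Icc 0 1) := fun t ht => (hWd t ht).continuousWithinAt
  set w : ℝ → E := fun t => u t - (s * a t) • W t with hw
  set w' : ℝ → E := fun t => u' t + s • ((N t / l) • W t - a t • A (u' t)) with hw'
  have hwd : ∀ t ∈ Set.Icc (0 : ℝ) 1, HasDerivWithinAt w (w' t) (Set.Icc 0 1) t := fun t ht => by
    have h1 := (hu t ht).sub ((((had t ht).hasDerivWithinAt (s := Set.Icc 0 1)).const_mul s).smul
      (hWd t ht))
    convert! h1 using 1
    simp only [hw']
    module
  have hw'c : ContinuousOn w' (Set.Icc 0 1) :=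
    hu'.add (((hNc.div_const l).smul hWc |>.sub (hac.smul
      (A.continuous.comp_continuousOn hu'))).const_smul s)
  have hpt : ∀ t ∈ Set.Icc (0 : ℝ) 1, w t ∈ T ∧ √(G (w t) (w' t) (w' t)) ≤
      N t + s * (dF (u t) (u' t) / l - K * (a t * N t) + η * N t) := fun t ht => by
    have h1 := hvar (u t) (huU t ht).1.1 (u' t) (a t) (N t / l) (ha0 t ht) (ha1 t ht)
      (div_nonneg (hN0 t) hl0.le) ?_ ?_
    · refine ⟨h1.1, ?_⟩
      rcases (hN0 t).eq_or_lt with h0 | h0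
      · have hu'0 : u' t = 0 := by
          have := hnorm t ht
          rw [← h0, mul_zero] at this
          exact norm_le_zero_iff.1 this
        simp [hw', hu'0, ← h0]
      · refine sqrt_le_add_of_le_sq (hN0 t) (fun h => absurd h h0.ne') (hG0 _ _) ?_
        refine h1.2.trans ?_
        rw [← hNsq]
        have h2 : η / C ^ 2 * ‖u' t‖ ^ 2 ≤ η * N t ^ 2 := by
          rw [div_mul_eq_mul_div, div_le_iff₀ (by positivity)]
          have := (huU t ht).2.1 (u' t)
          rw [← hNsq] at this
          nlinarith
        have h3 := mul_le_mul_of_nonneg_left h2 (by positivity : 0 ≤ 2 * s)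
        have h4 : 2 * s * (N t / l * dF (u t) (u' t)) = 2 * N t * (s * (dF (u t) (u' t) / l)) := by
          ring
        linarith
    · calc N t / l * r ≤ N t / l * l := by
            gcongr
        _ = N t := by field_simp
        _ ≤ √B * ‖u' t‖ := hNnorm t ht
        _ ≤ _ := by gcongr; linarith [mul_nonneg hC0.le (Real.sqrt_nonneg B)]
    · calc N t / l * ‖u t - u₀‖ ≤ N t / l * (C * l) := by
            gcongr
            exact hdisp t ht
        _ = C * N t := by field_simp
        _ ≤ C * (√B * ‖u' t‖) := by gcongr; exact hNnorm t ht
        _ ≤ _ := by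
          have : 0 ≤ √B * ‖u' t‖ := by positivity
          linarith
  refine ⟨w, w', hwd, hw'c, fun t ht => (hpt t ht).1, ?_, ?_, ?_⟩
  · simp [hw, ha, hW, hL0, hu0]
  · simp [hw, ha, hL1, hl0.ne']
  · have hwc : ContinuousOn w (Set.Icc 0 1) := fun t ht => (hwd t ht).continuousWithinAt
    have hlc : ContinuousOn (fun t => √(G (w t) (w' t) (w' t))) (Set.Icc 0 1) :=
      (((hGT.comp hwc fun t ht => (hpt t ht).1).clm_apply hw'c).clm_apply hw'c).sqrt
    have hdFc : ContinuousOn (fun t => dF (u t) (u' t)) (Set.Icc 0 1) :=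
      (hdFT.comp huc fun t ht => (huU t ht).1.2).clm_apply hu'
    have hrc : ContinuousOn
        (fun t => N t + s * (dF (u t) (u' t) / l - K * (a t * N t) + η * N t)) (Set.Icc 0 1) :=
      hNc.add ((((hdFc.div_const l).sub ((hac.mul hNc).const_smul K)).add
        (hNc.const_smul η)).const_smul s)
    have hrd : ∀ t ∈ Set.Ioo (0 : ℝ) 1, HasDerivAt
        (fun t => L t + s * (F (u t) / l + K * l / 2 * a t ^ 2 + η * L t))
        (N t + s * (dF (u t) (u' t) / l - K * (a t * N t) + η * N t)) t := fun t ht => by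
      have ht' := Set.Ioo_subset_Icc_self ht
      have h1 := (hFT (u t) (huU t ht').1.2).comp_hasDerivAt t
        ((hu t ht').hasDerivAt (Icc_mem_nhds ht.1 ht.2))
      have h2 := (hLd t ht').add ((((h1.div_const l).add
        (((had t ht').pow 2).const_mul (K * l / 2))).add ((hLd t ht').const_mul η)).const_mul s)
      convert! h2 using 1
      field_simp
      ring
    have hFc : ContinuousOn (fun t => F (u t)) (Set.Icc 0 1) := fun t ht =>
      (hFT (u t) (huU t ht).1.2).continuousAt.comp_continuousWithinAt (huc t ht)
    have hLc : ContinuousOn L (Set.Icc 0 1) := fun t ht =>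
      (hLd t ht).continuousAt.continuousWithinAt
    have hI := intervalIntegral.integral_eq_sub_of_hasDerivAt_of_le zero_le_one
      (hLc.add ((((hFc.div_const l).add ((hac.pow 2).const_smul (K * l / 2))).add
        (hLc.const_smul η)).const_smul s)) hrd
      (hrc.intervalIntegrable_of_Icc zero_le_one)
    refine (intervalIntegral.integral_mono_on zero_le_one (hlc.intervalIntegrable_of_Icc zero_le_one)
      (hrc.intervalIntegrable_of_Icc zero_le_one) fun t ht => (hpt t ht).2).trans ?_
    rw [hI]
    apply le_of_eq
    simp only [Pi.add_apply, Pi.smul_apply, Pi.pow_apply, smul_eq_mul, hL0, hL1, ha, hu0,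
      div_self hl0.ne', zero_div]
    ring

end CurveVariation

namespace Riemann

section Length

variable {E : Type*} [NormedAddCommGroup E] [NormedSpace ℝ E] [FiniteDimensional ℝ E]
  {H : Type*} [TopologicalSpace H] {I : ModelWithCorners ℝ E H} [I.Boundaryless]
  {M : Type*} [TopologicalSpace M] [ChartedSpace H M]
  [RiemannianBundle (fun x : M => TangentSpace I x)]
  [IsManifold I ∞ M] [IsContMDiffRiemannianBundle I ∞ E (fun x : M => TangentSpace I x)]

theorem mfderivWithin_eq_chartField {p : M} {γ : ℝ → M} {u u' : ℝ → E} {t : ℝ}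
    (ht : t ∈ Set.Icc (0 : ℝ) 1) (hγ : MDifferentiableWithinAt 𝓘(ℝ, ℝ) I γ (Set.Icc 0 1) t)
    (hs : γ t ∈ (extChartAt I p).source)
    (hu : ∀ t ∈ Set.Icc (0 : ℝ) 1, u t = extChartAt I p (γ t))
    (hu' : HasDerivWithinAt u (u' t) (Set.Icc 0 1) t) :
    mfderivWithin 𝓘(ℝ, ℝ) I γ (Set.Icc 0 1) t 1 = chartField I p (u' t) (γ t) := by
  have : IsManifold I 1 M := inferInstance
  have huniq : UniqueMDiffWithinAt 𝓘(ℝ, ℝ) (Set.Icc (0 : ℝ) 1) t :=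
    (uniqueDiffOn_Icc zero_lt_one t ht).uniqueMDiffWithinAt
  have h1 := mfderiv_comp_mfderivWithin t
    (mdifferentiableAt_extChartAt (I := I) (x := p) (by simpa using hs)) hγ huniq
  have h2 : mfderivWithin 𝓘(ℝ, ℝ) 𝓘(ℝ, E) (extChartAt I p ∘ γ) (Set.Icc 0 1) t
      = ContinuousLinearMap.smulRight (1 : ℝ →L[ℝ] ℝ) (u' t) := by
    have h3 : HasDerivWithinAt (extChartAt I p ∘ γ) (u' t) (Set.Icc 0 1) t :=
      hu'.congr (fun s hs => (hu s hs).symm) (hu t ht).symm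
    exact h3.hasFDerivWithinAt.hasMFDerivWithinAt.mfderivWithin huniq
  rw [← chartField_mfderiv hs (mfderivWithin 𝓘(ℝ, ℝ) I γ (Set.Icc 0 1) t 1)]
  congr 1
  have h4 := congrArg (fun L : ℝ →L[ℝ] E => L 1) (h1.symm.trans h2)
  refine Eq.trans h4 ?_
  simp

theorem pathELength_eq_ofReal_integral {p : M} {γ : ℝ → M} {u u' : ℝ → E}
    (hγ : ContMDiffOn 𝓘(ℝ, ℝ) I 1 γ (Set.Icc 0 1))
    (hs : ∀ t ∈ Set.Icc (0 : ℝ) 1, γ t ∈ (extChartAt I p).source)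
    (hu : ∀ t ∈ Set.Icc (0 : ℝ) 1, u t = extChartAt I p (γ t))
    (hu' : ∀ t ∈ Set.Icc (0 : ℝ) 1, HasDerivWithinAt u (u' t) (Set.Icc 0 1) t)
    (hu'c : ContinuousOn u' (Set.Icc 0 1)) :
    Manifold.pathELength I γ 0 1
      = ENNReal.ofReal (∫ t in (0 : ℝ)..1, √(chartMetric I p (u t) (u' t) (u' t))) := by
  have huc : ContinuousOn u (Set.Icc 0 1) := fun t ht => (hu' t ht).continuousWithinAt
  have hc : ContinuousOn (fun t => √(chartMetric I p (u t) (u' t) (u' t))) (Set.Icc 0 1) :=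
    ((((contDiffOn_chartMetric p).continuousOn.comp huc fun t ht => by
      rw [hu t ht]; exact (extChartAt I p).map_source (hs t ht)).clm_apply hu'c).clm_apply
      hu'c).sqrt
  rw [Manifold.pathELength_eq_lintegral_mfderivWithin_Icc,
    intervalIntegral.integral_of_le zero_le_one, ← MeasureTheory.integral_Icc_eq_integral_Ioc,
    MeasureTheory.ofReal_integral_eq_lintegral_ofReal (hc.integrableOn_Icc)
      (Filter.Eventually.of_forall fun t => Real.sqrt_nonneg _)]
  refine MeasureTheory.setLIntegral_congr_fun measurableSet_Icc fun t ht => ?_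
  rw [← ofReal_norm, mfderivWithin_eq_chartField ht (hγ.mdifferentiableOn one_ne_zero t ht)
    (hs t ht) hu (hu' t ht), hu t ht, chartMetric_extChartAt (hs t ht), real_inner_self_eq_norm_sq,
    Real.sqrt_sq (norm_nonneg _)]

theorem exists_hasDerivWithinAt_extChartAt {p : M} {γ : ℝ → M}
    (hγ : ContMDiffOn 𝓘(ℝ, ℝ) I 1 γ (Set.Icc 0 1))
    (hs : ∀ t ∈ Set.Icc (0 : ℝ) 1, γ t ∈ (extChartAt I p).source) :
    ∃ u' : ℝ → E, (∀ t ∈ Set.Icc (0 : ℝ) 1,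
      HasDerivWithinAt (fun t => extChartAt I p (γ t)) (u' t) (Set.Icc 0 1) t) ∧
      ContinuousOn u' (Set.Icc 0 1) := by
  have : IsManifold I 1 M := inferInstance
  have h : ContDiffOn ℝ 1 (fun t => extChartAt I p (γ t)) (Set.Icc 0 1) :=
    ((contMDiffOn_extChartAt (x := p)).comp hγ fun t ht => by simpa using hs t ht).contDiffOn
  exact ⟨derivWithin (fun t => extChartAt I p (γ t)) (Set.Icc 0 1),
    fun t ht => (h.differentiableOn one_ne_zero t ht).hasDerivWithinAt,
    h.continuousOn_derivWithin (uniqueDiffOn_Icc zero_lt_one) le_rfl⟩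

theorem contMDiffOn_extChartAt_symm_comp {p : M} {w w' : ℝ → E}
    (hw : ∀ t ∈ Set.Icc (0 : ℝ) 1, HasDerivWithinAt w (w' t) (Set.Icc 0 1) t)
    (hw'c : ContinuousOn w' (Set.Icc 0 1))
    (hT : ∀ t ∈ Set.Icc (0 : ℝ) 1, w t ∈ (extChartAt I p).target) :
    ContMDiffOn 𝓘(ℝ, ℝ) I 1 (fun t => (extChartAt I p).symm (w t)) (Set.Icc 0 1) := by
  have : IsManifold I 1 M := inferInstance
  have huniq := uniqueDiffOn_Icc (zero_lt_one' ℝ)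
  have h : ContDiffOn ℝ 1 w (Set.Icc 0 1) := by
    rw [show (1 : WithTop ℕ∞) = 0 + 1 by simp, contDiffOn_succ_iff_derivWithin huniq]
    refine ⟨fun t ht => (hw t ht).differentiableWithinAt, by simp, ?_⟩
    rw [contDiffOn_zero]
    exact hw'c.congr fun t ht => (hw t ht).derivWithin (huniq t ht)
  exact (contMDiffOn_extChartAt_symm p).comp h.contMDiffOn hT

end Length

section Dist

variable {E : Type*} [NormedAddCommGroup E] [NormedSpace ℝ E] [FiniteDimensional ℝ E]
  {H : Type*} [TopologicalSpace H] {I : ModelWithCorners ℝ E H} [I.Boundaryless]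
  {M : Type*} [MetricSpace M] [ChartedSpace H M]
  [RiemannianBundle (fun x : M => TangentSpace I x)]
  [IsManifold I ∞ M] [IsContMDiffRiemannianBundle I ∞ E (fun x : M => TangentSpace I x)]
  [IsRiemannianManifold I M]

theorem edist_le_pathELength {γ : ℝ → M} {a b : ℝ} (hab : a ≤ b)
    (hγ : ContMDiffOn 𝓘(ℝ, ℝ) I 1 γ (Set.Icc a b)) :
    edist (γ a) (γ b) ≤ Manifold.pathELength I γ a b := by
  rw [IsRiemannianManifold.out (I := I) (γ a) (γ b)]
  exact Manifold.riemannianEDist_le_pathELength hγ rfl rfl hab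

variable (I) in
theorem exists_path_of_dist_lt {x y : M} {r : ℝ} (h : dist x y < r) :
    ∃ γ : ℝ → M, γ 0 = x ∧ γ 1 = y ∧ ContMDiffOn 𝓘(ℝ, ℝ) I 1 γ (Set.Icc 0 1) ∧
      Manifold.pathELength I γ 0 1 < ENNReal.ofReal r :=
  Manifold.exists_lt_of_riemannianEDist_lt (by
    rw [← IsRiemannianManifold.out (I := I) x y, edist_dist]
    exact (ENNReal.ofReal_lt_ofReal_iff (dist_nonneg.trans_lt h)).2 h)

/-- Points on a path from `x` to `y` of length less than `r`. -/
theorem dist_add_dist_lt_of_pathELength_lt {γ : ℝ → M} {r : ℝ}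
    (hγ : ContMDiffOn 𝓘(ℝ, ℝ) I 1 γ (Set.Icc 0 1))
    (h : Manifold.pathELength I γ 0 1 < ENNReal.ofReal r) {t : ℝ} (ht : t ∈ Set.Icc (0 : ℝ) 1) :
    dist (γ 0) (γ t) + dist (γ t) (γ 1) < r := by
  have h1 := edist_le_pathELength ht.1 (hγ.mono (Set.Icc_subset_Icc_right ht.2))
  have h2 := edist_le_pathELength ht.2 (hγ.mono (Set.Icc_subset_Icc_left ht.1))
  have h3 := (add_le_add h1 h2).trans_lt ((Manifold.pathELength_add ht.1 ht.2).trans_lt h)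
  rw [edist_dist, edist_dist, ← ENNReal.ofReal_add dist_nonneg dist_nonneg] at h3
  exact (ENNReal.ofReal_lt_ofReal_iff' .. |>.1 h3).1

end Dist
end Riemann

namespace Riemann

section SecondDifference

variable {E : Type*} [NormedAddCommGroup E] [NormedSpace ℝ E] [FiniteDimensional ℝ E]
  {H : Type*} [TopologicalSpace H] {I : ModelWithCorners ℝ E H} [I.Boundaryless]

theorem exists_chartMetric_eq {M : Type*} [TopologicalSpace M] [ChartedSpace H M]
    [RiemannianBundle (fun x : M => TangentSpace I x)]
    [IsManifold I ∞ M] [IsContMDiffRiemannianBundle I ∞ E (fun x : M => TangentSpace I x)]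
    (p : M) (β : E →L[ℝ] E →L[ℝ] ℝ) :
    ∃ A : E →L[ℝ] E, ∀ w, chartMetric I p (extChartAt I p p) (A w) = β w := by
  have hp := mem_extChartAt_source (I := I) p
  obtain ⟨g, hg⟩ := LinearMap.exists_rightInverse_of_surjective
    (chartMetric I p (extChartAt I p p)).toLinearMap (LinearMap.range_eq_top.2 fun α => by
      refine ⟨mfderiv I 𝓘(ℝ, E) (extChartAt I p) p
        (sharp I p (α.comp (mfderiv I 𝓘(ℝ, E) (extChartAt I p) p))), ?_⟩
      ext v
      refine (chartMetric_extChartAt hp _ v).trans ?_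
      rw [chartField_mfderiv hp, inner_sharp]
      exact congrArg α (mfderiv_chartField hp v))
  refine ⟨LinearMap.toContinuousLinearMap (g ∘ₗ β.toLinearMap), fun w => ?_⟩
  exact congrArg (fun L => L (β w)) hg

variable {M : Type*} [MetricSpace M] [ChartedSpace H M]
  [RiemannianBundle (fun x : M => TangentSpace I x)]
  [IsManifold I ∞ M] [IsContMDiffRiemannianBundle I ∞ E (fun x : M => TangentSpace I x)]
  [IsRiemannianManifold I M]

/-- A discrete evolution variational inequality: the point `q` is `p` moved for a short time `s`
along `- grad f`. -/
theorem exists_dist_variation_le {f : M → ℝ} (hf : ContMDiff I 𝓘(ℝ, ℝ) 2 f) {p : M} {K : ℝ}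
    (hK : ∀ v : TangentSpace I p, K * ‖v‖ ^ 2 ≤ hess I f p v v) {η : ℝ} (hη : 0 < η) :
    ∃ R > 0, ∀ r, 0 < r → r < R → ∃ s > 0, ∃ q : M, ∀ x : M, dist p x = r →
      dist q x ≤ r + s * ((f x - f p) / r - K * r / 2 + η * r) := by
  have hp := mem_extChartAt_source (I := I) p
  set u₀ := extChartAt I p p with hu₀
  set F := f ∘ (extChartAt I p).symm with hF
  have hTo : IsOpen (extChartAt I p).target := isOpen_extChartAt_target p
  have hT : (extChartAt I p).target ∈ 𝓝 u₀ := extChartAt_target_mem_nhds p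
  have hFc : ContDiffOn ℝ 2 F (extChartAt I p).target := contDiffOn_chart hf p
  set V₀ : E := mfderiv I 𝓘(ℝ, E) (extChartAt I p) p (grad I f p) with hV₀
  have hV : chartField I p V₀ p = grad I f p := chartField_mfderiv hp _
  have hd2 : HasFDerivAt (fderiv ℝ F) (fderiv ℝ (fderiv ℝ F) u₀) u₀ :=
    (((hFc.contDiffAt hT).fderiv_right (m := 1) (by norm_num)).differentiableAt
      (by norm_num)).hasFDerivAt
  obtain ⟨A, hA⟩ := exists_chartMetric_eq (I := I) p
    (fderiv ℝ (fderiv ℝ F) u₀ - (fderiv ℝ (chartMetric I p) u₀).flip V₀)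
  obtain ⟨C, hC0, hC⟩ := exists_norm_sq_le_chartMetric (I := I) p
  obtain ⟨U, hU, hvar⟩ := exists_curve_variation (K := K) (F := F)
    ((contDiffAt_chartMetric (I := I) p).hasStrictFDerivAt (by norm_num)) hd2 (chartMetric_comm p)
    (chartMetric_grad (hf.mdifferentiable (by norm_num) p) hV) (A := A)
    (fun w => by rw [hA]; ext z; simp [hu₀])
    (fun v => by
      have h := hK (chartField I p v p)
      rw [hess_chartField hf hV, ← real_inner_self_eq_norm_sq, ← chartMetric_extChartAt hp] at h
      rw [chartMetric_comm p _ v (A v), hA]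
      simp only [sub_apply, ContinuousLinearMap.flip_apply]
      rw [← hu₀] at h
      have h2 : fderiv ℝ (chartMetric I p) u₀ v V₀ v = fderiv ℝ (chartMetric I p) u₀ v v V₀ := by
        rw [hu₀, ← mvfderiv_inner_chartField, ← mvfderiv_inner_chartField]
        simp_rw [real_inner_comm]
      linarith)
    hT (contDiffOn_chartMetric p).continuousOn
    (fun u hu => ((hFc.contDiffAt (hTo.mem_nhds hu)).differentiableAt (by norm_num)).hasFDerivAt)
    ((hFc.continuousOn_fderiv_of_isOpen hTo (by norm_num)))
    (chartMetric_self_nonneg p) hC0 hC hη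
  obtain ⟨R, hR0, hR⟩ := Metric.mem_nhds_iff.1 (Filter.inter_mem
    ((continuousAt_extChartAt (I := I) p).preimage_mem_nhds hU) (extChartAt_source_mem_nhds (I := I) p))
  refine ⟨R / 2, by positivity, fun r hr hrR => ?_⟩
  obtain ⟨s, hs, -, hvar⟩ := hvar r hr
  refine ⟨s, hs, (extChartAt I p).symm (u₀ - s • V₀), fun x hx => ?_⟩
  by_contra! hlt
  have hcont : ContinuousAt (fun l => l + s * ((f x - f p) / l - K * l / 2 + η * l)) r := by
    have := hr.ne'
    fun_prop (disch := assumption)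
  obtain ⟨δ, hδ0, hδ⟩ := Metric.eventually_nhds_iff.1 (hcont.eventually (eventually_lt_nhds hlt))
  obtain ⟨γ, h0, h1, hγ, hlen⟩ := exists_path_of_dist_lt I
    (show dist p x < r + min δ r by rw [hx]; have := lt_min hδ0 hr; linarith)
  have hmem : ∀ t ∈ Set.Icc (0 : ℝ) 1, γ t ∈ Metric.ball p R := fun t ht => by
    have h2 := dist_add_dist_lt_of_pathELength_lt hγ hlen ht
    rw [Metric.mem_ball, dist_comm, ← h0]
    have := dist_nonneg (x := γ t) (y := γ 1)
    have := min_le_right δ r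
    linarith
  have hsource : ∀ t ∈ Set.Icc (0 : ℝ) 1, γ t ∈ (extChartAt I p).source := fun t ht =>
    (hR (hmem t ht)).2
  obtain ⟨u', hu', hu'c⟩ := exists_hasDerivWithinAt_extChartAt hγ hsource
  have hl := pathELength_eq_ofReal_integral hγ hsource (fun _ _ => rfl) hu' hu'c
  set l := ∫ t in (0 : ℝ)..1, √(chartMetric I p (extChartAt I p (γ t)) (u' t) (u' t)) with hldef
  have hl0 : 0 ≤ l := intervalIntegral.integral_nonneg zero_le_one fun t _ => Real.sqrt_nonneg _
  have hrl : r ≤ l := by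
    have h2 := edist_le_pathELength zero_le_one hγ
    rw [hl, h0, h1, edist_dist, hx] at h2
    exact (ENNReal.ofReal_le_ofReal_iff hl0).1 h2
  have hlr : l < r + δ := by
    rw [hl] at hlen
    have h2 := (ENNReal.ofReal_lt_ofReal_iff'.1 hlen).1
    have := min_le_left δ r
    linarith
  obtain ⟨w, w', hw, hw'c, hwT, hw0, hw1, hwl⟩ := hvar (fun t => extChartAt I p (γ t)) u' hu' hu'c
    (fun t ht => (hR (hmem t ht)).1) (by simp only [h0]) l hldef hrl
  have hc := contMDiffOn_extChartAt_symm_comp hw hw'c hwT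
  have h2 := edist_le_pathELength zero_le_one hc
  rw [pathELength_eq_ofReal_integral hc (fun t ht => (extChartAt I p).map_target (hwT t ht))
    (fun t ht => ((extChartAt I p).right_inv (hwT t ht)).symm) hw hw'c, hw0, hw1,
    (extChartAt I p).left_inv (hsource 1 (by simp)), h1, edist_dist,
    ENNReal.ofReal_le_ofReal_iff (intervalIntegral.integral_nonneg zero_le_one
      fun t _ => Real.sqrt_nonneg _)] at h2
  have h3 := hδ (show dist l r < δ by rw [Real.dist_eq, abs_lt]; constructor <;> linarith)
  have hFx : F (extChartAt I p (γ 1)) = f x := by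
    rw [hF, Function.comp_apply, (extChartAt I p).left_inv (hsource 1 (by simp)), h1]
  have hFp : F u₀ = f p := by
    rw [hF, Function.comp_apply, hu₀, (extChartAt I p).left_inv hp]
  simp only [hFx] at hwl
  rw [← hu₀] at h2 hwl
  rw [hFp] at hwl
  linarith

/-- A lower bound for the Hessian at a single point `p` controls the second differences of `f`
along pairs of points whose metric midpoint is `p`. -/
theorem exists_second_difference_ge {f : M → ℝ} (hf : ContMDiff I 𝓘(ℝ, ℝ) 2 f) {p : M} {K c : ℝ}
    (hK : ∀ v : TangentSpace I p, K * ‖v‖ ^ 2 ≤ hess I f p v v) (hc : c < K) :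
    ∃ R > 0, ∀ r, 0 < r → r < R → ∀ x y : M, dist p x = r → dist p y = r → 2 * r ≤ dist x y →
      c * r ^ 2 ≤ f x + f y - 2 * f p := by
  obtain ⟨R, hR, h⟩ := exists_dist_variation_le hf hK (η := (K - c) / 2) (by linarith)
  refine ⟨R, hR, fun r hr hrR x y hx hy hxy => ?_⟩
  obtain ⟨s, hs, q, hq⟩ := h r hr hrR
  have h1 := hq x hx
  have h2 := hq y hy
  have h3 := dist_triangle_left x y q
  have h4 : 0 ≤ s * ((f x - f p) / r + (f y - f p) / r - c * r) := by nlinarith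
  have h5 := nonneg_of_mul_nonneg_right h4 hs
  have h6 : 0 ≤ r * ((f x - f p) / r + (f y - f p) / r - c * r) := by positivity
  have h7 : r * ((f x - f p) / r + (f y - f p) / r - c * r) = f x + f y - 2 * f p - c * r ^ 2 := by
    field_simp
    ring
  linarith

end SecondDifference
end Riemann

section LengthSpace

variable {X : Type*} [MetricSpace X]

/-- Between any two points there are points at any prescribed distance from the first one that lie
on an almost minimizing path. -/
def IsLengthLike (X : Type*) [MetricSpace X] : Prop :=
  ∀ (x y : X) (r a : ℝ), dist x y < r → 0 ≤ a → a ≤ dist x y → ∃ z, dist x z = a ∧ a + dist z y < r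

theorem IsLengthLike.totallyBounded_closedBall (h : IsLengthLike X) {x₀ : X} {R : ℝ}
    (hR : ∀ r < R, IsCompact (Metric.closedBall x₀ r)) :
    TotallyBounded (Metric.closedBall x₀ R) := by
  rw [Metric.totallyBounded_iff]
  intro ε hε
  have hK : IsCompact (insert x₀ (Metric.closedBall x₀ (R - ε / 3))) :=
    (hR _ (by linarith)).insert x₀
  obtain ⟨t, ht, hcov⟩ := Metric.totallyBounded_iff.1 hK.totallyBounded (ε / 3) (by positivity)
  refine ⟨t, ht, fun y hy => ?_⟩
  have hy' : dist x₀ y ≤ R := by rwa [dist_comm, ← Metric.mem_closedBall]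
  have hz : ∃ z ∈ insert x₀ (Metric.closedBall x₀ (R - ε / 3)), dist z y < 2 * ε / 3 := by
    rcases le_or_gt (dist x₀ y) (R - ε / 3) with h1 | h1
    · exact ⟨y, Or.inr (by rwa [Metric.mem_closedBall, dist_comm]), by rw [dist_self]; positivity⟩
    · rcases le_or_gt 0 (R - ε / 3) with h2 | h2
      · obtain ⟨z, hz1, hz2⟩ := h x₀ y (dist x₀ y + ε / 3) (R - ε / 3) (by linarith) h2 h1.le
        exact ⟨z, Or.inr (by rw [Metric.mem_closedBall, dist_comm, hz1]), by linarith⟩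
      · exact ⟨x₀, Or.inl rfl, by linarith⟩
  obtain ⟨z, hz, hzy⟩ := hz
  obtain ⟨w, hw, hzw⟩ := Set.mem_iUnion₂.1 (hcov hz)
  refine Set.mem_iUnion₂.2 ⟨w, hw, ?_⟩
  rw [Metric.mem_ball] at hzw ⊢
  have := dist_triangle y z w
  rw [dist_comm y z] at this
  linarith

/-- The Hopf-Rinow-Cohn-Vossen theorem: a complete locally compact length space is proper. -/
theorem IsLengthLike.properSpace (h : IsLengthLike X) [CompleteSpace X] [LocallyCompactSpace X] :
    ProperSpace X := by
  refine ⟨fun x₀ r₁ => ?_⟩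
  by_contra hr₁
  set S : Set ℝ := {r | IsCompact (Metric.closedBall x₀ r)} with hS
  have hdown : ∀ r ∈ S, ∀ r' ≤ r, r' ∈ S := fun r hr r' hr' =>
    hr.of_isClosed_subset Metric.isClosed_closedBall (Metric.closedBall_subset_closedBall hr')
  have h0 : (0 : ℝ) ∈ S := by simp [hS]
  have hbdd : BddAbove S := ⟨r₁, fun r hr => by
    by_contra! hlt
    exact hr₁ (hdown r hr r₁ hlt.le)⟩
  have hlt : ∀ r < sSup S, r ∈ S := fun r hr => by
    obtain ⟨r', hr', hrr'⟩ := exists_lt_of_lt_csSup ⟨0, h0⟩ hr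
    exact hdown r' hr' r hrr'.le
  have hK : IsCompact (Metric.closedBall x₀ (sSup S)) :=
    isCompact_iff_totallyBounded_isComplete.2 ⟨h.totallyBounded_closedBall hlt,
      Metric.isClosed_closedBall.isComplete⟩
  obtain ⟨δ, hδ, hδK⟩ := hK.exists_isCompact_cthickening
  have hmem : sSup S + δ / 2 ∈ S := by
    refine hδK.of_isClosed_subset Metric.isClosed_closedBall fun y hy => ?_
    have hy' : dist x₀ y ≤ sSup S + δ / 2 := by rwa [dist_comm, ← Metric.mem_closedBall]
    rcases le_or_gt (dist x₀ y) (sSup S) with h1 | h1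
    · exact Metric.self_subset_cthickening _ (by rwa [Metric.mem_closedBall, dist_comm])
    · obtain ⟨z, hz1, hz2⟩ := h x₀ y (dist x₀ y + δ / 2) (sSup S) (by linarith)
        (le_csSup hbdd h0) h1.le
      exact Metric.mem_cthickening_of_dist_le y z δ _
        (by rw [Metric.mem_closedBall, dist_comm, hz1]) (by rw [dist_comm]; linarith)
  linarith [le_csSup hbdd hmem]

theorem IsLengthLike.exists_dist_eq (h : IsLengthLike X) [ProperSpace X] (x y : X) {a : ℝ}
    (ha : 0 ≤ a) (hay : a ≤ dist x y) : ∃ z, dist x z = a ∧ dist z y = dist x y - a := by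
  have hne : (Metric.sphere x a).Nonempty := by
    obtain ⟨z, hz, -⟩ := h x y (dist x y + 1) a (by linarith) ha hay
    exact ⟨z, by rwa [Metric.mem_sphere, dist_comm]⟩
  obtain ⟨z, hz, hmin⟩ := (isCompact_sphere x a).exists_isMinOn hne
    (f := fun z => dist z y) (by fun_prop)
  rw [Metric.mem_sphere, dist_comm] at hz
  refine ⟨z, hz, le_antisymm (le_of_forall_pos_le_add fun ε hε => ?_) ?_⟩
  · obtain ⟨w, hw1, hw2⟩ := h x y (dist x y + ε) a (by linarith) ha hay
    have := hmin (show w ∈ Metric.sphere x a by rwa [Metric.mem_sphere, dist_comm])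
    simp only [Set.mem_ofPred_eq] at this
    linarith
  · have := dist_triangle x z y
    linarith

end LengthSpace

namespace Riemann

theorem isLengthLike {E : Type*} [NormedAddCommGroup E] [NormedSpace ℝ E] [FiniteDimensional ℝ E]
    {H : Type*} [TopologicalSpace H] (I : ModelWithCorners ℝ E H) [I.Boundaryless]
    (M : Type*) [MetricSpace M] [ChartedSpace H M]
    [RiemannianBundle (fun x : M => TangentSpace I x)]
    [IsManifold I ∞ M] [IsContMDiffRiemannianBundle I ∞ E (fun x : M => TangentSpace I x)]
    [IsRiemannianManifold I M] : IsLengthLike M := by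
  intro x y r a hr ha hay
  obtain ⟨γ, h0, h1, hγ, hlen⟩ := exists_path_of_dist_lt I hr
  have hc : ContinuousOn (fun t => dist (γ 0) (γ t)) (Set.Icc 0 1) :=
    Continuous.comp_continuousOn (by fun_prop : Continuous fun z => dist (γ 0) z) hγ.continuousOn
  obtain ⟨t, ht, hta⟩ := intermediate_value_Icc zero_le_one hc (show a ∈ _ by
    simpa [h0, h1] using ⟨ha, hay⟩)
  refine ⟨γ t, by rw [← h0]; exact hta, ?_⟩
  have := dist_add_dist_lt_of_pathELength_lt hγ hlen ht
  rw [h1] at this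
  simp only at hta
  linarith

theorem properSpace_of_completeSpace {E : Type*} [NormedAddCommGroup E] [NormedSpace ℝ E] [FiniteDimensional ℝ E]
    {H : Type*} [TopologicalSpace H] (I : ModelWithCorners ℝ E H) [I.Boundaryless]
    (M : Type*) [MetricSpace M] [ChartedSpace H M]
    [RiemannianBundle (fun x : M => TangentSpace I x)]
    [IsManifold I ∞ M] [IsContMDiffRiemannianBundle I ∞ E (fun x : M => TangentSpace I x)]
    [IsRiemannianManifold I M] [CompleteSpace M] : ProperSpace M := by
  have : LocallyCompactSpace M := Manifold.locallyCompact_of_finiteDimensional I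
  exact (isLengthLike I M).properSpace

section

variable {E : Type*} [NormedAddCommGroup E] [NormedSpace ℝ E] [FiniteDimensional ℝ E]
  {H : Type*} [TopologicalSpace H] {I : ModelWithCorners ℝ E H} [I.Boundaryless]
  {M : Type*} [MetricSpace M] [ChartedSpace H M]
  [RiemannianBundle (fun x : M => TangentSpace I x)]
  [IsManifold I ∞ M] [IsContMDiffRiemannianBundle I ∞ E (fun x : M => TangentSpace I x)]
  [IsRiemannianManifold I M]

theorem eventually_abs_fderiv_le {f : M → ℝ} (hf : ContMDiff I 𝓘(ℝ, ℝ) 2 f) (p : M) {ε : ℝ}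
    (hε : 0 < ε) : ∀ᶠ u in 𝓝 (extChartAt I p p), ∀ v,
      |fderiv ℝ (f ∘ (extChartAt I p).symm) u v|
        ≤ (‖grad I f p‖ + ε) * √(chartMetric I p u v v) := by
  have hp := mem_extChartAt_source (I := I) p
  have hT : (extChartAt I p).target ∈ 𝓝 (extChartAt I p p) := extChartAt_target_mem_nhds p
  set F := f ∘ (extChartAt I p).symm with hF
  set V₀ : E := mfderiv I 𝓘(ℝ, E) (extChartAt I p) p (grad I f p) with hV₀
  have hV : chartField I p V₀ p = grad I f p := chartField_mfderiv hp _
  obtain ⟨C, hC0, hC⟩ := exists_norm_sq_le_chartMetric (I := I) p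
  have hG : ContinuousAt (chartMetric I p) (extChartAt I p p) := (contDiffAt_chartMetric p).continuousAt
  have hdF : ContinuousAt (fderiv ℝ F) (extChartAt I p p) :=
    (((contDiffOn_chart hf p).contDiffAt hT).fderiv_right (m := 1) (by norm_num)).continuousAt
  have h1 : ∀ᶠ u in 𝓝 (extChartAt I p p), √(chartMetric I p u V₀ V₀) < ‖grad I f p‖ + ε / 2 := by
    have hc : ContinuousAt (fun u => √(chartMetric I p u V₀ V₀)) (extChartAt I p p) :=
      ((hG.clm_apply continuousAt_const).clm_apply continuousAt_const).sqrt
    refine hc.eventually (eventually_lt_nhds ?_)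
    simp only
    rw [chartMetric_extChartAt hp, hV, real_inner_self_eq_norm_sq, Real.sqrt_sq (norm_nonneg _)]
    linarith
  have h2 : ∀ᶠ u in 𝓝 (extChartAt I p p), ‖fderiv ℝ F u - chartMetric I p u V₀‖ < ε / (2 * C) := by
    have hc : ContinuousAt (fun u => ‖fderiv ℝ F u - chartMetric I p u V₀‖) (extChartAt I p p) :=
      (hdF.sub (hG.clm_apply continuousAt_const)).norm
    refine hc.eventually (eventually_lt_nhds ?_)
    simp only
    rw [chartMetric_grad (hf.mdifferentiable (by norm_num) p) hV, sub_self, norm_zero]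
    positivity
  filter_upwards [h1, h2, hC] with u hu1 hu2 hu3 v
  have h3 : |chartMetric I p u V₀ v| ≤ √(chartMetric I p u V₀ V₀) * √(chartMetric I p u v v) := by
    simp only [chartMetric_apply, real_inner_self_eq_norm_sq, Real.sqrt_sq (norm_nonneg _)]
    exact abs_real_inner_le_norm _ _
  have h4 : ‖v‖ ≤ C * √(chartMetric I p u v v) := by
    refine (abs_le_of_sq_le_sq' ?_ (by positivity)).2
    rw [mul_pow, Real.sq_sqrt (chartMetric_self_nonneg _ _ _)]
    exact hu3 v
  have h5 := (fderiv ℝ F u - chartMetric I p u V₀).le_of_opNorm_le hu2.le v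
  rw [Real.norm_eq_abs, sub_apply] at h5
  have h6 : ε / (2 * C) * ‖v‖ ≤ ε / (2 * C) * (C * √(chartMetric I p u v v)) := by gcongr
  have h7 : ε / (2 * C) * (C * √(chartMetric I p u v v)) = ε / 2 * √(chartMetric I p u v v) := by
    field_simp
  have h8 : √(chartMetric I p u V₀ V₀) * √(chartMetric I p u v v)
      ≤ (‖grad I f p‖ + ε / 2) * √(chartMetric I p u v v) := by gcongr
  have h9 := abs_add_le (fderiv ℝ F u v - chartMetric I p u V₀ v) (chartMetric I p u V₀ v)
  rw [sub_add_cancel] at h9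
  linarith

/-- Near `p` the function `f` decreases at most at the rate `‖grad f p‖ + ε`. -/
theorem eventually_abs_sub_le {f : M → ℝ} (hf : ContMDiff I 𝓘(ℝ, ℝ) 2 f) (p : M) {ε : ℝ}
    (hε : 0 < ε) : ∀ᶠ y in 𝓝 p, |f y - f p| ≤ (‖grad I f p‖ + ε) * dist p y := by
  have hTo : IsOpen (extChartAt I p).target := isOpen_extChartAt_target p
  obtain ⟨R, hR0, hR⟩ := Metric.mem_nhds_iff.1 (Filter.inter_mem
    ((continuousAt_extChartAt (I := I) p).eventually (eventually_abs_fderiv_le hf p hε))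
    (extChartAt_source_mem_nhds (I := I) p))
  set B := ‖grad I f p‖ + ε with hB
  have hB0 : 0 < B := by positivity
  filter_upwards [Metric.ball_mem_nhds p hR0] with y hy
  rw [Metric.mem_ball, dist_comm] at hy
  refine le_of_forall_pos_le_add fun δ hδ => ?_
  obtain ⟨γ, h0, h1, hγ, hlen⟩ := exists_path_of_dist_lt I
    (show dist p y < min R (dist p y + δ / B) from lt_min hy (lt_add_of_pos_right _ (by positivity)))
  have hmem : ∀ t ∈ Set.Icc (0 : ℝ) 1, γ t ∈ Metric.ball p R := fun t ht => by
    have h2 := dist_add_dist_lt_of_pathELength_lt hγ hlen ht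
    rw [Metric.mem_ball, dist_comm, ← h0]
    have := dist_nonneg (x := γ t) (y := γ 1)
    have := min_le_left R (dist p y + δ / B)
    linarith
  have hsource : ∀ t ∈ Set.Icc (0 : ℝ) 1, γ t ∈ (extChartAt I p).source := fun t ht =>
    (hR (hmem t ht)).2
  obtain ⟨u', hu', hu'c⟩ := exists_hasDerivWithinAt_extChartAt hγ hsource
  have hl := pathELength_eq_ofReal_integral hγ hsource (fun _ _ => rfl) hu' hu'c
  set u : ℝ → E := fun t => extChartAt I p (γ t) with hu
  set l := ∫ t in (0 : ℝ)..1, √(chartMetric I p (u t) (u' t) (u' t)) with hldef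
  have hld : l < dist p y + δ / B := by
    rw [hl] at hlen
    exact (ENNReal.ofReal_lt_ofReal_iff'.1 hlen).1.trans_le (min_le_right _ _)
  set F := f ∘ (extChartAt I p).symm with hF
  have hFc : ContDiffOn ℝ 2 F (extChartAt I p).target := contDiffOn_chart hf p
  have huT : ∀ t ∈ Set.Icc (0 : ℝ) 1, u t ∈ (extChartAt I p).target := fun t ht =>
    (extChartAt I p).map_source (hsource t ht)
  have huc : ContinuousOn u (Set.Icc 0 1) := fun t ht => (hu' t ht).continuousWithinAt
  have hdc : ContinuousOn (fun t => fderiv ℝ F (u t) (u' t)) (Set.Icc 0 1) :=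
    ((hFc.continuousOn_fderiv_of_isOpen hTo (by norm_num)).comp huc huT).clm_apply hu'c
  have hlc : ContinuousOn (fun t => √(chartMetric I p (u t) (u' t) (u' t))) (Set.Icc 0 1) :=
    ((((contDiffOn_chartMetric p).continuousOn.comp huc huT).clm_apply hu'c).clm_apply hu'c).sqrt
  have hI := intervalIntegral.integral_eq_sub_of_hasDerivAt_of_le zero_le_one
    (hFc.continuousOn.comp huc huT) (f' := fun t => fderiv ℝ F (u t) (u' t)) (fun t ht =>
      (((hFc.contDiffAt (hTo.mem_nhds (huT t (Set.Ioo_subset_Icc_self ht)))).differentiableAt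
        (by norm_num)).hasFDerivAt.comp_hasDerivAt t
        ((hu' t (Set.Ioo_subset_Icc_self ht)).hasDerivAt (Icc_mem_nhds ht.1 ht.2))))
    (hdc.intervalIntegrable_of_Icc zero_le_one)
  have hFu : ∀ t ∈ Set.Icc (0 : ℝ) 1, F (u t) = f (γ t) := fun t ht => by
    rw [hF, Function.comp_apply, hu, (extChartAt I p).left_inv (hsource t ht)]
  simp only [Function.comp_apply] at hI
  rw [hFu 1 (by simp), hFu 0 (by simp), h0, h1] at hI
  rw [← hI]
  have hle : |∫ t in (0 : ℝ)..1, fderiv ℝ F (u t) (u' t)| ≤ B * l := by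
    rw [hldef, ← intervalIntegral.integral_const_mul]
    refine (intervalIntegral.abs_integral_le_integral_abs zero_le_one).trans
      (intervalIntegral.integral_mono_on zero_le_one
        (hdc.abs.intervalIntegrable_of_Icc zero_le_one)
        ((hlc.const_smul B).intervalIntegrable_of_Icc zero_le_one) fun t ht => ?_)
    exact (hR (hmem t ht)).1 (u' t)
  have h3 : B * l ≤ B * (dist p y + δ / B) := by gcongr
  have h4 : B * (dist p y + δ / B) = B * dist p y + δ := by field_simp
  linarith

end
end Riemann

section DoubleIntegral

open MeasureTheory

/-- The second difference of a double antiderivative of `h`. -/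
theorem second_difference_le {h Γ P : ℝ → ℝ} (hh : Integrable h)
    (hP : ∀ s, P s = ∫ u in (0 : ℝ)..s, h u) (hΓ : ∀ t, HasDerivAt Γ (P t) t)
    {t r c : ℝ} (hr : 0 ≤ r) (hc : ∀ᵐ τ, τ ∈ Set.Icc (t - r) (t + r) → h τ ≤ c) :
    Γ (t + r) + Γ (t - r) - 2 * Γ t ≤ c * r ^ 2 := by
  set D : ℝ → ℝ := fun u => Γ (t + u) + Γ (t - u) - c * u ^ 2 with hD
  have hDd : ∀ u, HasDerivAt D (P (t + u) - P (t - u) - 2 * c * u) u := fun u => by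
    have h1 := (hΓ (t + u)).comp_const_add t u
    have h2 := (hΓ (t - u)).comp_const_sub t u
    have h3 := (h1.add h2).sub (((hasDerivAt_id u).pow 2).const_mul c)
    convert! h3 using 1
    simp
    ring
  have hanti : AntitoneOn D (Set.Icc 0 r) := by
    refine antitoneOn_of_deriv_nonpos (convex_Icc 0 r)
      (fun u _ => (hDd u).continuousAt.continuousWithinAt)
      (fun u _ => (hDd u).differentiableAt.differentiableWithinAt) fun u hu => ?_
    rw [interior_Icc] at hu
    rw [(hDd u).deriv, hP, hP, intervalIntegral.integral_interval_sub_left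
      hh.intervalIntegrable hh.intervalIntegrable]
    have h1 : ∫ τ in (t - u)..(t + u), h τ ≤ ∫ τ in (t - u)..(t + u), c := by
      refine intervalIntegral.integral_mono_ae_restrict (by linarith [hu.1]) hh.intervalIntegrable
        intervalIntegrable_const ?_
      refine (ae_restrict_iff' measurableSet_Icc).2 ?_
      filter_upwards [hc] with τ hτ hτ'
      exact hτ ⟨by linarith [hτ'.1, hu.2], by linarith [hτ'.2, hu.2]⟩
    rw [intervalIntegral.integral_const, smul_eq_mul] at h1
    linarith
  have := hanti (Set.left_mem_Icc.2 hr) (Set.right_mem_Icc.2 hr) hr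
  simp only [hD, add_zero, sub_zero] at this
  linarith

end DoubleIntegral

namespace Riemann

open MeasureTheory

/-- Comparison of `f` with the double integral of a function `h` that lies below an upper
semicontinuous strict minorant of `g`. -/
theorem le_of_hess_ge_of_upperSemicontinuous
    {E : Type*} [NormedAddCommGroup E] [NormedSpace ℝ E] [FiniteDimensional ℝ E]
    {H : Type*} [TopologicalSpace H] {I : ModelWithCorners ℝ E H} [I.Boundaryless]
    {M : Type*} [MetricSpace M] [ChartedSpace H M]
    [RiemannianBundle (fun x : M => TangentSpace I x)]
    [IsManifold I ∞ M] [IsContMDiffRiemannianBundle I ∞ E (fun x : M => TangentSpace I x)]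
    [IsRiemannianManifold I M] [CompleteSpace M]
    {f : M → ℝ} (hf : ContMDiff I 𝓘(ℝ, ℝ) 2 f) {x₀ : M} {g : ℝ → ℝ}
    (hHess : ∀ (x : M) (v : TangentSpace I x), g (dist x₀ x) * ‖v‖ ^ 2 ≤ hess I f x v v)
    {x : M} {k : ℝ → EReal} (hk : UpperSemicontinuous k) (hkg : ∀ t, k t < g t)
    {h : ℝ → ℝ} (hh : Integrable h)
    (hhk : ∀ᵐ t, t ∈ Set.Ioo 0 (dist x₀ x) → (h t : EReal) ≤ k t)
    {a : ℝ} (ha : ‖grad I f x₀‖ < a) :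
    f x₀ - a * dist x₀ x + ∫ s in (0 : ℝ)..dist x₀ x, ∫ u in (0 : ℝ)..s, h u ≤ f x := by
  have hlen := isLengthLike I M
  have : ProperSpace M := properSpace_of_completeSpace I M
  set L := dist x₀ x with hL
  set P : ℝ → ℝ := fun s => ∫ u in (0 : ℝ)..s, h u with hP
  set Γ : ℝ → ℝ := fun t => ∫ s in (0 : ℝ)..t, P s with hΓ
  have hPc : Continuous P := intervalIntegral.continuous_primitive (fun _ _ => hh.intervalIntegrable) 0
  have hΓd : ∀ t, HasDerivAt Γ (P t) t := fun t =>
    intervalIntegral.integral_hasDerivAt_right (hPc.intervalIntegrable _ _)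
      (hPc.stronglyMeasurableAtFilter _ _) hPc.continuousAt
  have hΓc : Continuous Γ := continuous_iff_continuousAt.2 fun t => (hΓd t).continuousAt
  have hΓ0 : Γ 0 = 0 := by simp [hΓ]
  by_contra! hlt
  set Φ : M → ℝ := fun m => f m - Γ (dist x₀ m) + a * dist x₀ m with hΦ
  set S : Set M := {m | dist x₀ m + dist m x = L} with hS
  have hSc : IsCompact S := by
    refine (isCompact_closedBall x₀ L).of_isClosed_subset
      (isClosed_eq (by fun_prop) continuous_const) fun m hm => ?_
    rw [Metric.mem_closedBall, dist_comm]
    have : dist x₀ m + dist m x = L := hm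
    linarith [dist_nonneg (x := m) (y := x)]
  have hx₀S : x₀ ∈ S := by simp [hS, hL]
  obtain ⟨m, hmS, hmax⟩ := hSc.exists_isMaxOn ⟨x₀, hx₀S⟩ (f := Φ) (by
    have := hf.continuous
    fun_prop)
  have hmax' : ∀ y ∈ S, Φ y ≤ Φ m := fun y hy => hmax hy
  have hΦ₀ : Φ x₀ = f x₀ := by simp [hΦ, hΓ0]
  have hΦx : Φ x < Φ m := by
    refine lt_of_lt_of_le ?_ (hmax' x₀ hx₀S)
    rw [hΦ₀]
    simp only [hΦ, ← hL]
    linarith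
  have hmL : dist x₀ m + dist m x = L := hmS
  have hmx : 0 < dist m x := dist_pos.2 fun hmx => by
    rw [hmx] at hΦx
    exact lt_irrefl _ hΦx
  rcases (dist_nonneg (x := x₀) (y := m)).eq_or_lt with h0 | h0
  · -- the maximum is not attained at `x₀`, by the bound on the gradient
    obtain rfl : x₀ = m := dist_eq_zero.1 h0.symm
    set ε := (a - ‖grad I f x₀‖) / 3 with hε
    have hε0 : 0 < ε := by rw [hε]; linarith
    obtain ⟨R, hR0, hR⟩ := Metric.eventually_nhds_iff.1 (eventually_abs_sub_le hf x₀ hε0)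
    have hΓo : ∀ᶠ t in 𝓝 (0 : ℝ), |Γ t| ≤ ε * |t| := by
      have h1 := (hΓd 0).isLittleO.def hε0
      filter_upwards [h1] with t ht
      simpa [hΓ0, hP] using ht
    obtain ⟨R', hR'0, hR'⟩ := Metric.eventually_nhds_iff.1 hΓo
    obtain ⟨r, hr0, hrR, hrR', hrL⟩ : ∃ r, 0 < r ∧ r < R ∧ r < R' ∧ r ≤ L :=
      ⟨min (min R R' / 2) L, lt_min (by positivity) hmx,
        (min_le_left _ _).trans_lt (by linarith [min_le_left R R', lt_min hR0 hR'0]),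
        (min_le_left _ _).trans_lt (by linarith [min_le_right R R', lt_min hR0 hR'0]),
        min_le_right _ _⟩
    obtain ⟨y, hy1, hy2⟩ := hlen.exists_dist_eq x₀ x hr0.le hrL
    have hyS : y ∈ S := by simp only [hS, Set.mem_ofPred_eq]; linarith
    have h1 := hmax' y hyS
    rw [hΦ₀] at h1
    simp only [hΦ, hy1] at h1
    have h2 := (abs_le.1 (hR (show dist y x₀ < R by rw [dist_comm]; linarith))).1
    rw [hy1] at h2
    have h3 := (abs_le.1 (hR' (show dist r 0 < R' by simpa [abs_of_pos hr0] using hrR'))).2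
    rw [abs_of_pos hr0] at h3
    have h4 : 3 * ε = a - ‖grad I f x₀‖ := by rw [hε]; ring
    have h5 : 0 < ε * r := by positivity
    have h6 : 3 * ε * r = (a - ‖grad I f x₀‖) * r := by rw [h4]
    linarith
  · -- nor at an intermediate point, by the bound on the Hessian
    set t := dist x₀ m with ht
    obtain ⟨c, hkc, hcg⟩ := EReal.lt_iff_exists_real_btwn.1 (hkg t)
    obtain ⟨c', hcc', hc'g⟩ := exists_between (EReal.coe_lt_coe_iff.1 hcg)
    obtain ⟨R, hR0, hR⟩ := exists_second_difference_ge hf (hHess m) hc'g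
    obtain ⟨R', hR'0, hR'⟩ := Metric.eventually_nhds_iff.1 (hk t c hkc)
    obtain ⟨r, hr0, hrR, hrR', hrt, hrx⟩ : ∃ r, 0 < r ∧ r < R ∧ r < R' ∧ r < t ∧ r < dist m x := by
      obtain ⟨r, hr0, hr⟩ := exists_between (lt_min (lt_min hR0 hR'0) (lt_min h0 hmx))
      simp only [lt_min_iff] at hr
      exact ⟨r, hr0, hr.1.1, hr.1.2, hr.2.1, hr.2.2⟩
    obtain ⟨y, hy1, hy2⟩ := hlen.exists_dist_eq x₀ m (a := t - r) (by linarith) (by linarith)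
    obtain ⟨z, hz1, hz2⟩ := hlen.exists_dist_eq m x hr0.le hrx.le
    rw [← ht, sub_sub_cancel] at hy2
    have hyx := dist_triangle y m x
    have hyx' := dist_triangle x₀ y x
    have hyS : y ∈ S := by simp only [hS, Set.mem_ofPred_eq]; linarith
    have hz₀ := dist_triangle x₀ m z
    have hz₀' := dist_triangle x₀ z x
    have hz3 : dist x₀ z = t + r := by linarith
    have hzS : z ∈ S := by simp only [hS, Set.mem_ofPred_eq]; linarith
    have hyz := dist_triangle x₀ y z
    have h1 := hR r hr0 hrR y z (by rw [dist_comm]; exact hy2) hz1 (by linarith)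
    have h2 : Γ (t + r) + Γ (t - r) - 2 * Γ t ≤ c * r ^ 2 := by
      refine second_difference_le hh (fun _ => rfl) hΓd hr0.le ?_
      filter_upwards [hhk] with τ hτ hτ'
      have h3 := hτ ⟨by linarith [hτ'.1], by linarith [hτ'.2]⟩
      have h4 := hR' (show dist τ t < R' by
        rw [Real.dist_eq, abs_lt]; constructor <;> linarith [hτ'.1, hτ'.2])
      exact_mod_cast (h3.trans_lt h4).le
    have h3 := hmax' y hyS
    have h4 := hmax' z hzS
    simp only [hΦ, hy1, hz3, ← ht] at h3 h4
    have h5 : c * r ^ 2 < c' * r ^ 2 := by gcongr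
    linarith

end Riemann

namespace Riemann

open MeasureTheory

theorem PiecewiseContinuousOnHalfLine.exists_abs_le {g : ℝ → ℝ}
    (hg : PiecewiseContinuousOnHalfLine g) (T : ℝ) : ∃ C, ∀ t ∈ Set.Icc 0 T, |g t| ≤ C := by
  refine isCompact_Icc.induction_on (p := fun s => ∃ C, ∀ t ∈ s, |g t| ≤ C) ⟨0, by simp⟩
    (fun s t hst ⟨C, hC⟩ => ⟨C, fun τ hτ => hC τ (hst hτ)⟩)
    (fun s t ⟨C, hC⟩ ⟨C', hC'⟩ => ⟨max C C', fun τ hτ => ?_⟩) (fun t ht => ?_)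
  · rcases hτ with hτ | hτ
    · exact (hC τ hτ).trans (le_max_left _ _)
    · exact (hC' τ hτ).trans (le_max_right _ _)
  · have hright : ∃ C, ∀ᶠ s in 𝓝[>] t, |g s| ≤ C := by
      obtain ⟨l, hl⟩ := hg.2.1 t ht.1
      exact ⟨|l| + 1, (hl.abs.eventually (eventually_lt_nhds (lt_add_one |l|))).mono
        fun s hs => hs.le⟩
    have hleft : ∃ C, ∀ᶠ s in 𝓝[<] t, 0 ≤ s → |g s| ≤ C := by
      rcases ht.1.eq_or_lt with rfl | h0
      · refine ⟨0, ?_⟩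
        filter_upwards [self_mem_nhdsWithin] with s hs h
        exact absurd hs (not_lt.2 h)
      · obtain ⟨l, hl⟩ := hg.2.2 t h0
        exact ⟨|l| + 1, (hl.abs.eventually (eventually_lt_nhds (lt_add_one |l|))).mono
          fun s hs _ => hs.le⟩
    obtain ⟨C, hC⟩ := hright
    obtain ⟨C', hC'⟩ := hleft
    rw [eventually_nhdsWithin_iff] at hC hC'
    refine ⟨{s | 0 ≤ s ∧ |g s| ≤ max (max C C') |g t|}, ?_, _, fun s hs => hs.2⟩
    filter_upwards [mem_nhdsWithin_of_mem_nhds hC, mem_nhdsWithin_of_mem_nhds hC',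
      self_mem_nhdsWithin] with s hs hs' hsT
    refine ⟨hsT.1, ?_⟩
    rcases lt_trichotomy s t with h | rfl | h
    · exact (hs' h hsT.1).trans ((le_max_right _ _).trans (le_max_left _ _))
    · exact le_max_right _ _
    · exact (hs h).trans ((le_max_left _ _).trans (le_max_left _ _))

theorem PiecewiseContinuousOnHalfLine.integrableOn {g : ℝ → ℝ}
    (hg : PiecewiseContinuousOnHalfLine g) (T : ℝ) : IntegrableOn g (Set.Icc 0 T) := by
  obtain ⟨C, hC⟩ := hg.exists_abs_le T
  set D := {t ∈ Set.Icc 0 T | ¬ ContinuousWithinAt g (Set.Ici 0) t} with hD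
  have hDf : D.Finite := hg.1 T
  have hmeas : AEStronglyMeasurable g (volume.restrict (Set.Icc 0 T)) := by
    have h1 : ContinuousOn g (Set.Icc 0 T \ D) := fun t ht => by
      have h2 : ContinuousWithinAt g (Set.Ici 0) t := by
        by_contra hcon
        exact ht.2 ⟨ht.1, hcon⟩
      exact h2.mono fun s hs => hs.1.1
    have h3 := h1.aestronglyMeasurable (μ := volume) (measurableSet_Icc.diff hDf.measurableSet)
    rwa [Measure.restrict_congr_set (sdiff_null_ae_eq_self (hDf.measure_zero _))] at h3
  exact Integrable.of_bound hmeas C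
    ((ae_restrict_iff' measurableSet_Icc).2 (Filter.Eventually.of_forall hC))

/-- The comparison theorem: a lower bound for the Hessian gives a lower bound for the function. -/
theorem comparison_le
    {E : Type*} [NormedAddCommGroup E] [NormedSpace ℝ E] [FiniteDimensional ℝ E]
    {H : Type*} [TopologicalSpace H] {I : ModelWithCorners ℝ E H} [I.Boundaryless]
    {M : Type*} [MetricSpace M] [ChartedSpace H M]
    [RiemannianBundle (fun x : M => TangentSpace I x)]
    [IsManifold I ∞ M] [IsContMDiffRiemannianBundle I ∞ E (fun x : M => TangentSpace I x)]
    [IsRiemannianManifold I M] [CompleteSpace M]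
    {f : M → ℝ} (hf : ContMDiff I 𝓘(ℝ, ℝ) 2 f) (x₀ : M) {g : ℝ → ℝ}
    (hHess : ∀ (x : M) (v : TangentSpace I x), g (dist x₀ x) * ‖v‖ ^ 2 ≤ hess I f x v v)
    (hg : ∀ T, IntegrableOn g (Set.Icc 0 T)) (x : M) :
    comparison I f x₀ g ⟨dist x₀ x, dist_nonneg⟩ ≤ f x := by
  set L := dist x₀ x with hL
  have hL0 : 0 ≤ L := dist_nonneg
  simp only [comparison]
  refine le_of_forall_pos_le_add fun ε hε => ?_
  set δ := ε / (2 * (L + 1)) with hδ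
  have hδ0 : 0 < δ := by positivity
  have hgi : Integrable g (volume.restrict (Set.Ioc 0 L)) :=
    (hg L).mono_set Set.Ioc_subset_Icc_self
  obtain ⟨k, hkg, hk, hki, hkb, hkint⟩ := exists_upperSemicontinuous_lt_integral_gt g hgi hδ0
  have hkR : ∀ᵐ t, t ∈ Set.Ioc 0 L → ((k t).toReal : EReal) = k t := by
    rw [ae_restrict_iff' measurableSet_Ioc] at hkb
    filter_upwards [hkb] with t ht htL
    exact EReal.coe_toReal ((hkg t).trans (EReal.coe_lt_top _)).ne (ht htL).ne'
  set h : ℝ → ℝ := (Set.Ioc 0 L).indicator fun t => (k t).toReal with hh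
  have hhi : Integrable h := (integrable_indicator_iff measurableSet_Ioc).2 hki
  have hhL : ∀ t ∈ Set.Ioc 0 L, h t = (k t).toReal := fun t ht => Set.indicator_of_mem ht _
  have hmain := le_of_hess_ge_of_upperSemicontinuous hf hHess (x := x) hk hkg hhi (by
    filter_upwards [hkR] with t ht htL
    have h1 := Set.Ioo_subset_Ioc_self htL
    rw [hhL t h1, ht h1]) (a := ‖grad I f x₀‖ + δ) (by linarith)
  rw [← hL] at hmain
  have hgI : ∀ a ∈ Set.Icc 0 L, ∀ b ∈ Set.Icc 0 L, IntervalIntegrable g volume a b :=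
    fun a ha b hb => by
      rw [intervalIntegrable_iff]
      exact (hg L).mono_set ((Set.uIoc_subset_uIcc).trans (Set.uIcc_subset_Icc ha hb))
  have h0L : (0 : ℝ) ∈ Set.Icc 0 L := Set.left_mem_Icc.2 hL0
  have hinner : ∀ s ∈ Set.Icc 0 L, ∫ u in (0 : ℝ)..s, g u ≤ (∫ u in (0 : ℝ)..s, h u) + δ :=
    fun s hs => by
      have h1 : ∫ u in s..L, h u ≤ ∫ u in s..L, g u := by
        refine intervalIntegral.integral_mono_ae_restrict hs.2 hhi.intervalIntegrable
          (hgI s hs L (Set.right_mem_Icc.2 hL0)) ?_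
        rw [Filter.EventuallyLE, ← restrict_Ioc_eq_restrict_Icc,
          ae_restrict_iff' measurableSet_Ioc]
        filter_upwards [hkR] with t ht htL
        have h1 : t ∈ Set.Ioc 0 L := ⟨hs.1.trans_lt htL.1, htL.2⟩
        have h2 := hkg t
        rw [← ht h1, EReal.coe_lt_coe_iff, ← hhL t h1] at h2
        exact h2.le
      have h2 : ∫ u in (0 : ℝ)..L, g u ≤ (∫ u in (0 : ℝ)..L, h u) + δ := by
        rw [intervalIntegral.integral_of_le hL0, intervalIntegral.integral_of_le hL0,
          setIntegral_congr_fun measurableSet_Ioc hhL]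
        exact hkint.le
      rw [← intervalIntegral.integral_add_adjacent_intervals (hgI 0 h0L s hs)
        (hgI s hs L (Set.right_mem_Icc.2 hL0)),
        ← intervalIntegral.integral_add_adjacent_intervals (b := s) hhi.intervalIntegrable
        hhi.intervalIntegrable] at h2
      linarith
  have hPg : ContinuousOn (fun s => ∫ u in (0 : ℝ)..s, g u) (Set.Icc 0 L) :=
    intervalIntegral.continuousOn_primitive_interval (by rw [Set.uIcc_of_le hL0]; exact hg L) |>.mono
      (by rw [Set.uIcc_of_le hL0])
  have hPh : Continuous (fun s => ∫ u in (0 : ℝ)..s, h u) :=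
    intervalIntegral.continuous_primitive (fun _ _ => hhi.intervalIntegrable) 0
  have houter : ∫ s in (0 : ℝ)..L, ∫ u in (0 : ℝ)..s, g u ≤
      ∫ s in (0 : ℝ)..L, ((∫ u in (0 : ℝ)..s, h u) + δ) :=
    intervalIntegral.integral_mono_on hL0 (hPg.intervalIntegrable_of_Icc hL0)
    ((hPh.add continuous_const).intervalIntegrable (μ := volume) 0 L) hinner
  rw [intervalIntegral.integral_add (hPh.intervalIntegrable _ _) intervalIntegrable_const,
    intervalIntegral.integral_const, smul_eq_mul, sub_zero] at houter
  have hδL : 2 * (δ * L) ≤ ε := by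
    have : δ * (2 * (L + 1)) = ε := by rw [hδ]; field_simp
    linarith
  linarith

end Riemann

end

theorem mainTheorem3 {n : ℕ}
    {M : Type*} [MetricSpace M] [ChartedSpace (EuclideanSpace ℝ (Fin n)) M]
    [IsManifold (𝓡 n) ∞ M]
    [RiemannianBundle (fun x : M => TangentSpace (𝓡 n) x)]
    [IsContMDiffRiemannianBundle (𝓡 n) ∞ (EuclideanSpace ℝ (Fin n))
      (fun x : M => TangentSpace (𝓡 n) x)]
    [IsRiemannianManifold (𝓡 n) M]
    [CompleteSpace M]
    (f : M → ℝ) (hf : ContMDiff (𝓡 n) 𝓘(ℝ, ℝ) 2 f)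
    (x₀ : M) (g : ℝ → ℝ) (hg : Riemann.PiecewiseContinuousOnHalfLine g)
    (hHess : ∀ (x : M) (v : TangentSpace (𝓡 n) x),
      g (dist x₀ x) * ‖v‖ ^ 2 ≤ Riemann.hess (𝓡 n) f x v v)
    (hG : IsProperMap (Riemann.comparison (𝓡 n) f x₀ g))
    (hGbdd : BddBelow (Set.range (Riemann.comparison (𝓡 n) f x₀ g))) :
    IsProperMap f := by
  have : ProperSpace M := Riemann.properSpace_of_completeSpace (𝓡 n) M
  rw [isProperMap_iff_isCompact_preimage]
  refine ⟨hf.continuous, fun K hK => ?_⟩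
  obtain ⟨b, hb⟩ := hK.bddAbove
  obtain ⟨m, hm⟩ := hGbdd
  have hc : IsCompact ((fun t : Set.Ici (0 : ℝ) => (t : ℝ)) ''
      (Riemann.comparison (𝓡 n) f x₀ g ⁻¹' Set.Icc m b)) :=
    (hG.isCompact_preimage isCompact_Icc).image continuous_subtype_val
  obtain ⟨R, hR⟩ := hc.bddAbove
  refine (isCompact_closedBall x₀ R).of_isClosed_subset (hK.isClosed.preimage hf.continuous)
    fun x hx => ?_
  rw [Metric.mem_closedBall, dist_comm]
  exact hR ⟨⟨dist x₀ x, dist_nonneg⟩, ⟨hm ⟨_, rfl⟩,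
    (Riemann.comparison_le hf x₀ hHess hg.integrableOn x).trans (hb hx)⟩, rfl⟩
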